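/- Let $M^{\mathrm{out}}$ be a smooth Riemannian manifold of dimension $m+1$ with metric $g^{\mathrm{out}}$ and let $f:M\to M^{\mathrm{out}}$ be an immersed smooth hypersurface, $\dim M=m$ (for example a submanifold $M\subset M^{\mathrm{out}}$), with induced metric $g=f^*g^{\mathrm{out}}$; identify $T_pM$ with $df(T_pM)\subset T_{f(p)}M^{\mathrm{out}}$. Let $\nabla^{\mathrm{out}}$, $\nabla$ be the Levi-Civita connections and $R^{\mathrm{out}}$, $R$ the curvature tensors of $g^{\mathrm{out}}$ and $g$, with $R_{X,Y}=\nabla_X\nabla_Y-\nabla_Y\nabla_X-\nabla_{[X,Y]}$. Given a (local) unit normal field $N$ of $M$, define the second fundamental form by $\nabla^{\mathrm{out}}_XY=\nabla_XY+\mathrm{II}(X,Y)N$ for vector fields $X,Y$ on $M$, and the shape operator $\mathrm{II}:TM\to TM$ by $g(\mathrm{II}_X,Y)=\mathrm{II}(X,Y)$; replacing $N$ by $-N$ changes $\mathrm{II}$ only by a sign. The intermediate curvature is $R^{\mathrm{inter}}_{X,Y}Z=\mathrm{pr}^\perp_{TM}(R^{\mathrm{out}}_{X,Y}Z)$ for $X,Y,Z\in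 T_pM$, where $\mathrm{pr}^\perp_{TM}$ is the orthogonal projection onto $TM$. The Ricci endomorphism $\mathrm{Ric}$ and the intermediate Ricci endomorphism $\mathrm{Ric}^{\mathrm{inter}}$ of $TM$ are defined by $$g(\mathrm{Ric}\,X,Y)=\mathrm{tr}_{TM}(Z\mapsto R_{Z,X}Y),\qquad g(\mathrm{Ric}^{\mathrm{inter}}X,Y)=\mathrm{tr}_{TM}(Z\mapsto R^{\mathrm{inter}}_{Z,X}Y).$$ The hypersurface $M$ is called permeable if $$R_{X,Y}\,\mathrm{II}_Z+R_{Y,Z}\,\mathrm{II}_X+R_{Z,X}\,\mathrm{II}_Y=0\qquad\text{for all }p\in M,\ X,Y,Z\in T_pM .$$ Then the following hold. 1. If $M$ is permeable, then $[\mathrm{Ric},\mathrm{II}]=0$ and $[\mathrm{Ric}^{\mathrm{inter}},\mathrm{II}]=0$ on $M$. 2. Suppose that $m=3$ (a $3$-dimensional hypersurface in a $4$-dimensional manifold), or that $M^{\mathrm{out}}$ is conformally flat, i.e. every point of $M^{\mathrm{out}}$ has an open neighbourhood $U$ with a smooth function $\varphi:U\to\mathbb{R}$ such that the metric $e^{2\varphi}g^{\mathrm{out}}$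 on $U$ has vanishing curvature tensor. If $[\mathrm{Ric}^{\mathrm{inter}},\mathrm{II}]=0$ on $M$, then $M$ is permeable. 3. In particular, if all sectional curvatures of $M^{\mathrm{out}}$ are equal to one constant $c\in\mathbb{R}$ (as in every space form), then $M$ is permeable. -/

import Mathlib

open Bundle Filter Topology Manifold
open scoped ContDiff

set_option maxSynthPendingDepth 3

noncomputable section

namespace Hypersurface

/-! ## Multilinear algebra on a single tangent space -/

section Algebra

variable {V W : Type*} [NormedAddCommGroup V] [NormedSpace ℝ V]
  [NormedAddCommGroup W] [NormedSpace ℝ W]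

/-- The linear form `w ↦ B(v, w)` is `B v`; for a nondegenerate bilinear form `B` on a
finite-dimensional space, `sharp B` is the inverse isomorphism, which sends a linear form `α` to the
vector `v` with `B(v, w) = α(w)` for all `w`. -/
def sharp (B : V →L[ℝ] V →L[ℝ] ℝ) : (V →L[ℝ] ℝ) →L[ℝ] V := B.inverse

/-- The endomorphism `A` associated to a bilinear form `b` by means of the scalar product `B`, that
is `B(A X, Y) = b(X, Y)`. -/
def endOfForm (B b : V →L[ℝ] V →L[ℝ] ℝ) : V →L[ℝ] V := (sharp B).comp b

/-- Interchanging the two arguments of a bilinear map, as a continuous linear operation. -/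
def swapCLM (V W : Type*) [NormedAddCommGroup V] [NormedSpace ℝ V] [NormedAddCommGroup W]
    [NormedSpace ℝ W] : (V →L[ℝ] V →L[ℝ] W) →L[ℝ] V →L[ℝ] V →L[ℝ] W :=
  (ContinuousLinearMap.flipₗᵢ ℝ V V W).toContinuousLinearEquiv.toContinuousLinearMap

theorem swapCLM_apply (b : V →L[ℝ] V →L[ℝ] W) (v w : V) : swapCLM V W b v w = b w v := rfl

/-- Three-linear maps `(X, Y, Z) ↦ R_{X,Y} Z`. -/
abbrev Curv (V : Type*) [NormedAddCommGroup V] [NormedSpace ℝ V] : Type _ :=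
  V →L[ℝ] V →L[ℝ] V →L[ℝ] V

/-- The trace of endomorphisms, as a continuous linear form. -/
def trCLM (V : Type*) [NormedAddCommGroup V] [NormedSpace ℝ V] [FiniteDimensional ℝ V] :
    (V →L[ℝ] V) →L[ℝ] ℝ :=
  LinearMap.toContinuousLinearMap (LinearMap.trace ℝ V ∘ₗ ContinuousLinearMap.coeLM ℝ)

/-- The Ricci form `Ric(X, Y) = tr (Z ↦ R_{Z,X} Y)`, see `ricciForm_apply`. -/
def ricciForm [FiniteDimensional ℝ V] (R : Curv V) : V →L[ℝ] V →L[ℝ] ℝ :=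
  (ContinuousLinearMap.compL ℝ V (V →L[ℝ] V) ℝ (trCLM V)).comp
    ((swapCLM V V).comp R.flip)

theorem ricciForm_apply [FiniteDimensional ℝ V] (R : Curv V) (X Y : V) :
    ricciForm R X Y = LinearMap.trace ℝ V
      { toFun := fun Z => R Z X Y
        map_add' := fun a b => by simp
        map_smul' := fun c a => by simp } := rfl

/-- The Ricci endomorphism, `B(Ric X, Y) = Ric(X, Y)`. -/
def ricciEnd [FiniteDimensional ℝ V] (B : V →L[ℝ] V →L[ℝ] ℝ) (R : Curv V) : V →L[ℝ] V :=
  endOfForm B (ricciForm R)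

end Algebra

/-! ## Metrics on an open subset of a vector space -/

section Local

variable {V : Type*} [NormedAddCommGroup V] [NormedSpace ℝ V]

/-- The Christoffel symbols of the first kind of a metric `G` given in a chart:
`Γ₁(v, w)(z) = ½ (∂_v G(w, z) + ∂_w G(v, z) - ∂_z G(v, w))`, see `christoffelFirst_apply`. -/
def christoffelFirst (G : V → V →L[ℝ] V →L[ℝ] ℝ) (x : V) : V →L[ℝ] V →L[ℝ] V →L[ℝ] ℝ :=
  (1 / 2 : ℝ) • (fderiv ℝ G x + (fderiv ℝ G x).flip
    - (swapCLM V ℝ).comp (fderiv ℝ G x).flip)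

theorem christoffelFirst_apply (G : V → V →L[ℝ] V →L[ℝ] ℝ) (x v w z : V) :
    christoffelFirst G x v w z =
      (1 / 2 : ℝ) * (fderiv ℝ G x v w z + fderiv ℝ G x w v z - fderiv ℝ G x z v w) := rfl

/-- The Christoffel symbols `Γ(v, w) = (∇_v w)(x)` of the Levi-Civita connection of `G` for constant
vector fields `v, w`. -/
def christoffel (G : V → V →L[ℝ] V →L[ℝ] ℝ) (x : V) : V →L[ℝ] V →L[ℝ] V :=
  (ContinuousLinearMap.compL ℝ V (V →L[ℝ] ℝ) V (sharp (G x))).comp (christoffelFirst G x)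

theorem christoffel_apply (G : V → V →L[ℝ] V →L[ℝ] ℝ) (x v w : V) :
    christoffel G x v w = sharp (G x) (christoffelFirst G x v w) := rfl

/-- The covariant derivative `∇_u (∇_v w)` at `x` of constant vector fields. -/
def secondCovariant (G : V → V →L[ℝ] V →L[ℝ] ℝ) (x : V) : Curv V :=
  fderiv ℝ (christoffel G) x
    + (ContinuousLinearMap.compL ℝ V V V).bilinearComp (christoffel G x) (christoffel G x)

theorem secondCovariant_apply (G : V → V →L[ℝ] V →L[ℝ] ℝ) (x u v w : V) :
    secondCovariant G x u v w =
      fderiv ℝ (christoffel G) x u v w + christoffel G x u (christoffel G x v w) := rfl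

/-- The curvature tensor `R_{u,v} w = ∇_u ∇_v w - ∇_v ∇_u w` of the Levi-Civita connection of `G`,
for constant (hence commuting) vector fields `u, v, w`. -/
def localCurvature (G : V → V →L[ℝ] V →L[ℝ] ℝ) (x : V) : Curv V :=
  secondCovariant G x - (secondCovariant G x).flip

theorem localCurvature_apply (G : V → V →L[ℝ] V →L[ℝ] ℝ) (x u v w : V) :
    localCurvature G x u v w = secondCovariant G x u v w - secondCovariant G x v u w := rfl

end Local

/-! ## Riemannian geometry of manifolds

A manifold of dimension `n` is modelled on `E n`. In Mathlib the tangent space `TangentSpace (𝓡 n) p`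
is by definition the vector space `E n`, via the preferred chart `extChartAt (𝓡 n) p` at `p`, and
derivatives `mfderiv` are computed in the preferred charts. -/

section Manifold

/-- The model space. -/
abbrev E (n : ℕ) : Type := EuclideanSpace ℝ (Fin n)

variable {n k : ℕ}
  {M : Type*} [TopologicalSpace M] [ChartedSpace (E n) M]
  {N : Type*} [TopologicalSpace N] [ChartedSpace (E k) N]

/-- A family of bilinear forms on the tangent spaces of `M`. -/
abbrev FormField (n : ℕ) (M : Type*) [TopologicalSpace M] [ChartedSpace (E n) M] : Type _ :=
  (p : M) → (TangentSpace (𝓡 n) p →L[ℝ] TangentSpace (𝓡 n) p →L[ℝ] ℝ)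

/-- The value of a family of bilinear forms at `p`, on the vector space `E n` underlying the tangent
space. -/
def FormField.at (g : FormField n M) (p : M) : E n →L[ℝ] E n →L[ℝ] ℝ := g p

/-- The derivative of `f` at `p` as a linear map between the vector spaces underlying the tangent
spaces. -/
def differential (f : M → N) (p : M) : E n →L[ℝ] E k := mfderiv (𝓡 n) (𝓡 k) f p

/-- The pullback `(f^*g)_p(X, Y) = g_{f(p)}(df X, df Y)`. -/
def pullback (f : M → N) (g : FormField k N) : FormField n M := fun p =>
  ((g.at (f p)).bilinearComp (differential f p) (differential f p) : E n →L[ℝ] E n →L[ℝ] ℝ)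

/-- The coordinate expression of `g` in the preferred chart at `p`. -/
def inChart (g : FormField n M) (p : M) : E n → E n →L[ℝ] E n →L[ℝ] ℝ := fun x =>
  FormField.at (pullback (extChartAt (𝓡 n) p).symm g) x

/-- The Christoffel symbols at `p` of `g` in the preferred chart at `p`. -/
def christoffelAt (g : FormField n M) (p : M) : E n →L[ℝ] E n →L[ℝ] E n :=
  christoffel (inChart g p) (extChartAt (𝓡 n) p p)

/-- The Riemann curvature tensor of `g` at `p`, a tensor on the tangent space at `p`. It is computed
in the preferred chart at `p`, the one which identifies the tangent space at `p` with `E n`. -/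
def curvature (g : FormField n M) (p : M) : Curv (E n) :=
  localCurvature (inChart g p) (extChartAt (𝓡 n) p p)

/-- The sectional curvature of the plane spanned by `X` and `Y`. -/
def sectionalCurvature (g : FormField n M) (p : M) (X Y : E n) : ℝ :=
  g.at p (curvature g p X Y Y) X / (g.at p X X * g.at p Y Y - g.at p X Y ^ 2)

/-- All sectional curvatures of `g` are equal to `c`. -/
def HasConstantCurvature (g : FormField n M) (c : ℝ) : Prop :=
  ∀ (p : M) (X Y : E n), LinearIndependent ℝ ![X, Y] → sectionalCurvature g p X Y = c

/-- `(M, g)` is conformally flat: every point has an open neighbourhood `U` with a smooth function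
`φ` on `U` such that the metric `e^{2φ} g` on `U` is flat. -/
def IsConformallyFlat (g : FormField n M) : Prop :=
  ∀ q : M, ∃ U : Set M, IsOpen U ∧ q ∈ U ∧ ∃ φ : M → ℝ,
    ContMDiffOn (𝓡 n) 𝓘(ℝ, ℝ) ∞ φ U ∧
      ∀ p ∈ U, curvature (fun y : M => Real.exp (2 * φ y) • g y) p = 0

end Manifold

section Immersed

/-! ## Hypersurfaces

`f : M → N` is a map from a manifold of dimension `n` to a manifold of dimension `n + 1`, and `g` is
the metric of `N` (the outer metric). -/

variable (n : ℕ)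
  {M : Type*} [TopologicalSpace M] [ChartedSpace (E n) M]
  {N : Type*} [TopologicalSpace N] [ChartedSpace (E (n + 1)) N]

/-- `f : M → N` is a smooth immersion. -/
structure IsSmoothImmersion (f : M → N) : Prop where
  contMDiff : ContMDiff (𝓡 n) (𝓡 (n + 1)) ∞ f
  injective_mfderiv : ∀ p : M, Function.Injective (mfderiv (𝓡 n) (𝓡 (n + 1)) f p)

/-- The Riemannian curvature tensor `R` of `M` with the induced metric. -/
def innerCurvature (f : M → N) (g : FormField (n + 1) N) (p : M) : Curv (E n) :=
  curvature (pullback f g) p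

/-- The orthogonal projection of the tangent space of `N` at `f p` to the tangent space of `M` at
`p`: the vector `tangentialProjection n f g p W` is the vector `X` with
`(f^*g)(X, Y) = g(W, df Y)` for all `Y`. -/
def tangentialProjection (f : M → N) (g : FormField (n + 1) N) (p : M) : E (n + 1) →L[ℝ] E n :=
  (sharp ((pullback f g).at p)).comp
    (((ContinuousLinearMap.compL ℝ (E n) (E (n + 1)) ℝ).flip (differential f p)).comp (g.at (f p)))

theorem tangentialProjection_apply (f : M → N) (g : FormField (n + 1) N) (p : M) (W : E (n + 1)) :
    tangentialProjection n f g p W =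
      sharp ((pullback f g).at p) ((g.at (f p) W).comp (differential f p)) := rfl

/-- The intermediate curvature: `R^inter_{X,Y} Z` is the tangential projection of
`R^out_{df X, df Y} (df Z)`, see `intermediateCurvature_apply`. -/
def intermediateCurvature (f : M → N) (g : FormField (n + 1) N) (p : M) : Curv (E n) :=
  (ContinuousLinearMap.compL ℝ (E n) (E (n + 1) →L[ℝ] E (n + 1)) (E n →L[ℝ] E n)
    ((ContinuousLinearMap.compL ℝ (E n) (E (n + 1)) (E n) (tangentialProjection n f g p)).comp
      ((ContinuousLinearMap.compL ℝ (E n) (E (n + 1)) (E (n + 1))).flip (differential f p)))).comp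
    ((curvature g (f p)).bilinearComp (differential f p) (differential f p))

theorem intermediateCurvature_apply (f : M → N) (g : FormField (n + 1) N) (p : M) (X Y Z : E n) :
    intermediateCurvature n f g p X Y Z =
      tangentialProjection n f g p
        (curvature g (f p) (differential f p X) (differential f p Y) (differential f p Z)) := rfl

/-- The Ricci endomorphism of `M` with the induced metric. -/
def innerRicci (f : M → N) (g : FormField (n + 1) N) (p : M) : E n →L[ℝ] E n :=
  ricciEnd ((pullback f g).at p) (innerCurvature n f g p)

/-- The intermediate Ricci endomorphism. -/
def intermediateRicci (f : M → N) (g : FormField (n + 1) N) (p : M) : E n →L[ℝ] E n :=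
  ricciEnd ((pullback f g).at p) (intermediateCurvature n f g p)

/-- The difference `(X, Y) ↦ ∇^out_X (df Y) - df (∇_X Y)` at `p`, a vector tangent to `N` at `f p`.
For the constant vector fields `X, Y` in the preferred chart at `p`, with `F` the coordinate
expression of `f`, it reads
`D²F(X, Y) + Γ^out(DF X, DF Y) - DF (Γ(X, Y))`, see `hessian_apply`. -/
def hessian (f : M → N) (g : FormField (n + 1) N) (p : M) : E n →L[ℝ] E n →L[ℝ] E (n + 1) :=
  fderiv ℝ (fderiv ℝ (writtenInExtChartAt (𝓡 n) (𝓡 (n + 1)) p f)) (extChartAt (𝓡 n) p p)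
    + (christoffelAt g (f p)).bilinearComp (differential f p) (differential f p)
    - (ContinuousLinearMap.compL ℝ (E n) (E n) (E (n + 1)) (differential f p)).comp
        (christoffelAt (pullback f g) p)

theorem hessian_apply (f : M → N) (g : FormField (n + 1) N) (p : M) (X Y : E n) :
    hessian n f g p X Y =
      fderiv ℝ (fderiv ℝ (writtenInExtChartAt (𝓡 n) (𝓡 (n + 1)) p f)) (extChartAt (𝓡 n) p p) X Y
        + christoffelAt g (f p) (differential f p X) (differential f p Y)
        - differential f p (christoffelAt (pullback f g) p X Y) := rfl

/-- `ν` is a unit normal vector of the hypersurface at `p`. -/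
def IsUnitNormal (f : M → N) (g : FormField (n + 1) N) (p : M) (ν : E (n + 1)) : Prop :=
  g.at (f p) ν ν = 1 ∧ ∀ X : E n, g.at (f p) ν (differential f p X) = 0

/-- The second fundamental form at `p` with respect to the unit normal vector `ν`; it is defined by
`∇^out_X Y = ∇_X Y + II(X, Y) ν`, that is `II(X, Y) = g(ν, ∇^out_X Y - ∇_X Y)`. -/
def secondFundamentalForm (f : M → N) (g : FormField (n + 1) N) (p : M) (ν : E (n + 1)) :
    E n →L[ℝ] E n →L[ℝ] ℝ :=
  (ContinuousLinearMap.compL ℝ (E n) (E (n + 1)) ℝ (g.at (f p) ν)).comp (hessian n f g p)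

theorem secondFundamentalForm_apply (f : M → N) (g : FormField (n + 1) N) (p : M) (ν : E (n + 1))
    (X Y : E n) :
    secondFundamentalForm n f g p ν X Y = g.at (f p) ν (hessian n f g p X Y) := rfl

/-- The shape operator `II`, `(f^*g)(II X, Y) = II(X, Y)`. -/
def shapeOperator (f : M → N) (g : FormField (n + 1) N) (p : M) (ν : E (n + 1)) : E n →L[ℝ] E n :=
  endOfForm ((pullback f g).at p) (secondFundamentalForm n f g p ν)

/-- The hypersurface is permeable: the vector-valued `3`-form
`R_{X,Y} II_Z + R_{Y,Z} II_X + R_{Z,X} II_Y` vanishes at every point, where `II` is formed with a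
unit normal vector `ν` at the point (`ν` and `-ν` give the same condition). -/
def IsPermeable (f : M → N) (g : FormField (n + 1) N) : Prop :=
  ∀ (p : M) (ν : E (n + 1)), IsUnitNormal n f g p ν → ∀ X Y Z : E n,
    innerCurvature n f g p X Y (shapeOperator n f g p ν Z)
      + innerCurvature n f g p Y Z (shapeOperator n f g p ν X)
      + innerCurvature n f g p Z X (shapeOperator n f g p ν Y) = 0

end Immersed

end Hypersurface

end

/-! For a curvature-like tensor `R` and a self-adjoint `A` put `F(X,Y,Z) = R_{X,Y} AZ + R_{Y,Z} AX +
R_{Z,X} AY` (`permeabilityForm`). This form is alternating, and permeability is its vanishing for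
the inner curvature and `A = II`.

By the Gauss equation, `R - R^inter` sends `(X,Y,Z)` to `II(Y,Z) II_X - II(X,Z) II_Y`. This
contributes nothing to `F`, because `g(II Y, II Z)` is symmetric and the cyclic sum cancels. Hence
`R` and `R^inter` have the same `F` (`permeabilityForm_innerCurvature`).

The trace of `X ↦ F(X,Y,Z)` is `Ric(Y, AZ) - Ric(Z, AY)`: the middle term is the product of a skew
and a self-adjoint map, so it is traceless. All these traces vanish exactly when `[Ric, A] = 0`
(`IsCurvatureTensor.commute_ricciEnd_iff`). Part 1 follows at once, for both curvatures.

For the converse, `F` must be recovered from its trace. In dimension 3 an alternating `F` is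
determined by it (`permeabilityForm_eq_zero_of_three`). In the conformally flat case `R^inter` is a
Kulkarni–Nomizu product of `g` with some `g(T·,·)`, and its Ricci form is `(m-2) g(T·,·) + tr(T) g`.
For `m ≠ 2` the hypothesis therefore makes `T` commute with `II`, which forces `F = 0`; for `m = 2`
an alternating 3-form vanishes anyway. Constant curvature is the case where `T` is a multiple of the
identity.

The analytic input, namely the curvature symmetries, the Gauss equation and the conformal change
formula, is proved in coordinates and then carried to the manifold through the preferred charts. -/

namespace Hypersurface

/-! ### Nondegenerate bilinear forms -/

section ScalarProduct

variable {V : Type*} [NormedAddCommGroup V] [NormedSpace ℝ V]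

theorem isInvertible_of_pos [FiniteDimensional ℝ V] {B : V →L[ℝ] V →L[ℝ] ℝ}
    (hB : ∀ v, v ≠ 0 → 0 < B v v) : B.IsInvertible := by
  have hinj : Function.Injective (B : V →ₗ[ℝ] V →L[ℝ] ℝ) := by
    rw [← LinearMap.ker_eq_bot, LinearMap.ker_eq_bot']
    intro v hv
    by_contra hne
    have h1 := hB v hne
    have h2 : B v = 0 := hv
    simp [h2] at h1
  have hdim : Module.finrank ℝ V = Module.finrank ℝ (V →L[ℝ] ℝ) := by
    rw [← (LinearMap.toContinuousLinearMap (𝕜 := ℝ) (E := V) (F' := ℝ)).finrank_eq]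
    exact (Subspace.dual_finrank_eq (K := ℝ) (V := V)).symm
  exact ⟨(LinearMap.linearEquivOfInjective _ hinj hdim).toContinuousLinearEquiv, by ext; rfl⟩

variable {B : V →L[ℝ] V →L[ℝ] ℝ}

theorem apply_sharp (hB : B.IsInvertible) (α : V →L[ℝ] ℝ) (w : V) : B (sharp B α) w = α w :=
  congrArg (fun β : V →L[ℝ] ℝ => β w) (hB.self_apply_inverse α)

theorem apply_endOfForm (hB : B.IsInvertible) (b : V →L[ℝ] V →L[ℝ] ℝ) (v w : V) :
    B (endOfForm B b v) w = b v w := apply_sharp hB (b v) w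

theorem ext_of_form (hB : B.IsInvertible) {v v' : V} (h : ∀ w, B v w = B v' w) : v = v' :=
  hB.injective (ContinuousLinearMap.ext h)

end ScalarProduct

/-! ### Algebraic curvature tensors, the permeability form and its trace -/

section CurvatureAlgebra

variable {V : Type*} [NormedAddCommGroup V] [NormedSpace ℝ V] {B : V →L[ℝ] V →L[ℝ] ℝ}

/-- The algebraic symmetries of a Riemannian curvature tensor. -/
structure IsCurvatureTensor (B : V →L[ℝ] V →L[ℝ] ℝ) (R : Curv V) : Prop where
  antisymm : ∀ X Y Z, R X Y Z = -R Y X Z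
  skew : ∀ X Y Z W, B (R X Y Z) W = -B (R X Y W) Z
  pair : ∀ X Y Z W, B (R X Y Z) W = B (R Z W X) Y
  bianchi : ∀ X Y Z W, B (R X Y Z) W + B (R Y Z X) W + B (R Z X Y) W = 0

/-- The vector-valued form whose vanishing is permeability. -/
noncomputable def permeabilityForm (R : Curv V) (A : V →L[ℝ] V) (X Y Z : V) : V :=
  R X Y (A Z) + R Y Z (A X) + R Z X (A Y)

/-- The endomorphism `X ↦ permeabilityForm R A X Y Z`. -/
noncomputable def permeabilityEnd (R : Curv V) (A : V →L[ℝ] V) (Y Z : V) : V →L[ℝ] V :=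
  (R.flip Y).flip (A Z) + (R Y Z).comp A + (R Z).flip (A Y)

theorem permeabilityEnd_apply (R : Curv V) (A : V →L[ℝ] V) (X Y Z : V) :
    permeabilityEnd R A Y Z X = permeabilityForm R A X Y Z := rfl

theorem permeabilityForm_add (R R' : Curv V) (A : V →L[ℝ] V) (X Y Z : V) :
    permeabilityForm (R + R') A X Y Z = permeabilityForm R A X Y Z + permeabilityForm R' A X Y Z := by
  simp only [permeabilityForm, add_apply]
  abel

/-- The symmetric bilinear forms `b` and `c` with endomorphisms `S` and `T` enter the
permeability form of a Kulkarni–Nomizu product only through the symmetry of `b ∘ A` and `c ∘ A`. -/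
theorem permeabilityForm_eq_zero_of_kulkarniNomizu {R : Curv V} {A S T : V →L[ℝ] V}
    {b c : V → V → ℝ} (hR : ∀ X Y Z, R X Y Z = b Y Z • S X - b X Z • S Y + c Y Z • T X - c X Z • T Y)
    (hb : ∀ Y Z, b Y (A Z) = b Z (A Y)) (hc : ∀ Y Z, c Y (A Z) = c Z (A Y)) (X Y Z : V) :
    permeabilityForm R A X Y Z = 0 := by
  simp only [permeabilityForm, hR]
  rw [hb Z X, hb Y X, hb Z Y, hc Z X, hc Y X, hc Z Y]
  abel

/-- Together with the cyclic invariance below, this makes the form alternating, which is all that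
the arguments in dimensions 2 and 3 use about it. -/
theorem permeabilityForm_self_left {R : Curv V} (hR : ∀ X Y Z, R X Y Z = -R Y X Z)
    (A : V →L[ℝ] V) (X Z : V) : permeabilityForm R A X X Z = 0 := by
  have h : R X X (A Z) = 0 := by
    have h2 : (2 : ℝ) • R X X (A Z) = 0 := by
      rw [two_smul]
      exact eq_neg_iff_add_eq_zero.mp (hR X X (A Z))
    exact (smul_eq_zero.mp h2).resolve_left two_ne_zero
  rw [permeabilityForm, h, hR Z X]
  abel

theorem permeabilityForm_rotate (R : Curv V) (A : V →L[ℝ] V) (X Y Z : V) :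
    permeabilityForm R A X Y Z = permeabilityForm R A Y Z X := by
  simp only [permeabilityForm]
  abel

theorem permeabilityForm_self_right {R : Curv V} (hR : ∀ X Y Z, R X Y Z = -R Y X Z)
    (A : V →L[ℝ] V) (X Y : V) : permeabilityForm R A X Y Y = 0 := by
  rw [permeabilityForm_rotate, permeabilityForm_self_left hR]

theorem permeabilityForm_self_outer {R : Curv V} (hR : ∀ X Y Z, R X Y Z = -R Y X Z)
    (A : V →L[ℝ] V) (X Y : V) : permeabilityForm R A X Y X = 0 := by
  rw [permeabilityForm_rotate, permeabilityForm_self_right hR]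

/-- `permeabilityEnd` packages linearity in the first slot only; cyclic rotation brings each of the
other slots to the front in turn. -/
theorem permeabilityForm_eq_zero_of_basis {ι : Type*} (e : Module.Basis ι ℝ V) {R : Curv V}
    {A : V →L[ℝ] V} (h : ∀ i j k, permeabilityForm R A (e i) (e j) (e k) = 0) (X Y Z : V) :
    permeabilityForm R A X Y Z = 0 := by
  have h0 : ∀ P : V →L[ℝ] V, (∀ i, P (e i) = 0) → ∀ X, P X = 0 := fun P hP X =>
    congrArg (fun L : V →ₗ[ℝ] V => L X)
      (e.ext (f₁ := (P : V →ₗ[ℝ] V)) (f₂ := 0) fun i => hP i)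
  have h1 : ∀ X j k, permeabilityForm R A X (e j) (e k) = 0 := fun X j k =>
    h0 (permeabilityEnd R A (e j) (e k)) (fun i => h i j k) X
  have h2 : ∀ X Y k, permeabilityForm R A X Y (e k) = 0 := fun X Y k => by
    rw [permeabilityForm_rotate, permeabilityForm_rotate]
    rw [← permeabilityForm_rotate]
    exact h0 (permeabilityEnd R A (e k) X) (fun j => by
      rw [permeabilityEnd_apply, ← permeabilityForm_rotate, h1]) Y
  rw [← permeabilityForm_rotate]
  exact h0 (permeabilityEnd R A X Y) (fun k => by
      rw [permeabilityEnd_apply, permeabilityForm_rotate, h2]) Z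

/-- Three indices out of two must repeat. This settles surfaces, where the Ricci form of a
Kulkarni–Nomizu product carries no information about `T`. -/
theorem permeabilityForm_eq_zero_of_two {R : Curv V} (hR : ∀ X Y Z, R X Y Z = -R Y X Z)
    (A : V →L[ℝ] V) (e : Module.Basis (Fin 2) ℝ V) (X Y Z : V) : permeabilityForm R A X Y Z = 0 := by
  refine permeabilityForm_eq_zero_of_basis e (fun i j k => ?_) X Y Z
  have h : i = j ∨ j = k ∨ i = k := by omega
  rcases h with rfl | rfl | rfl
  · exact permeabilityForm_self_left hR A _ _
  · exact permeabilityForm_self_right hR A _ _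
  · exact permeabilityForm_self_outer hR A _ _

/-- A curvature tensor with constant sectional curvature `c` is `c` times the standard one. -/
theorem IsCurvatureTensor.apply_eq_of_planes {R : Curv V} (hR : IsCurvatureTensor B R)
    {c : ℝ} (hs : ∀ v w, B v w = B w v)
    (h : ∀ X Y, B (R X Y Y) X = c * (B X X * B Y Y - B X Y ^ 2)) (X Y Z W : V) :
    B (R X Y Z) W = c * (B Y Z * B X W - B X Z * B Y W) := by
  -- Polarization in the second vector of the plane, and then in the first one (`h6`).
  have h3 : ∀ X Y Z, B (R X Y Z) X = c * (B X X * B Y Z - B X Y * B X Z) := fun X Y Z => by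
    have h1 := h X (Y + Z)
    have h2 := h X Y
    have h4 := h X Z
    have h5 : B (R X Y Z) X = B (R X Z Y) X := by
      rw [hR.pair X Y Z X, hR.antisymm Z X, map_neg, neg_apply, hR.skew X Z X Y]
      ring
    simp only [map_add, add_apply] at h1
    rw [hs Z Y] at h1
    linear_combination (h1 - h2 - h4 + h5) / 2
  have h6 : ∀ X Y Z W, B (R X Y Z) W + B (R W Y Z) X =
      c * (2 * B X W * B Y Z - B X Y * B W Z - B W Y * B X Z) := fun X Y Z W => by
    have h1 := h3 (X + W) Y Z
    have h2 := h3 X Y Z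
    have h4 := h3 W Y Z
    simp only [map_add, add_apply] at h1
    rw [hs W X] at h1
    linear_combination h1 - h2 - h4
  -- By the symmetries, the left side of `e1 - e2` is twice the `(X,Y,Z)` term minus the two other
  -- cyclic terms, hence three times the `(X,Y,Z)` term by Bianchi.
  have e1 := h6 X Y Z W
  have e2 := h6 Y X Z W
  have p1 := hR.pair W Y Z X
  have p2 := hR.pair W X Z Y
  have s1 := hR.skew Z X W Y
  have s2 := hR.skew Z Y W X
  have a1 : B (R Y X Z) W = -B (R X Y Z) W := by rw [hR.antisymm, map_neg, neg_apply]
  have a2 : B (R Z Y X) W = -B (R Y Z X) W := by rw [hR.antisymm, map_neg, neg_apply]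
  have b1 := hR.bianchi X Y Z W
  rw [hs W Z, hs W Y] at e1
  rw [hs W Z, hs W X, hs Y X] at e2
  linear_combination (e1 - e2 + b1 + a1 - a2 - p1 + p2 - s1 + s2) / 3

variable [FiniteDimensional ℝ V]

theorem trCLM_smulRight (α : V →L[ℝ] ℝ) (v : V) : trCLM V (α.smulRight v) = α v :=
  LinearMap.trace_smulRight (R := ℝ) (α : V →ₗ[ℝ] ℝ) v

theorem trCLM_id : trCLM V (ContinuousLinearMap.id ℝ V) = Module.finrank ℝ V :=
  LinearMap.trace_id ℝ V

theorem trCLM_comp_comm (L L' : V →L[ℝ] V) : trCLM V (L.comp L') = trCLM V (L'.comp L) :=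
  LinearMap.trace_comp_comm' (R := ℝ) (L' : V →ₗ[ℝ] V) (L : V →ₗ[ℝ] V)

/-- Mutually adjoint endomorphisms have the same trace. -/
theorem trCLM_eq_of_adjoint (hB : B.IsInvertible) {L L' : V →L[ℝ] V}
    (h : ∀ x y, B (L x) y = B x (L' y)) : trCLM V L = trCLM V L' := by
  obtain ⟨e, he⟩ := hB
  let e' : V ≃ₗ[ℝ] Module.Dual ℝ V :=
    e.toLinearEquiv.trans (LinearMap.toContinuousLinearMap (𝕜 := ℝ) (E := V) (F' := ℝ)).symm
  have he' : ∀ x y, e' x y = B x y := fun x y => by rw [← he]; rfl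
  -- Under the isomorphism of `V` with its dual given by `B`, `L` becomes the transpose of `L'`.
  have hc : e'.conj (L : V →ₗ[ℝ] V) = Module.Dual.transpose (R := ℝ) (L' : V →ₗ[ℝ] V) := by
    ext φ y
    obtain ⟨x, rfl⟩ := e'.surjective φ
    rw [LinearEquiv.conj_apply_apply, e'.symm_apply_apply, he']
    exact (h x y).trans (he' x (L' y)).symm
  have h1 := LinearMap.trace_conj' (L : V →ₗ[ℝ] V) e'
  rw [hc, LinearMap.trace_transpose'] at h1
  exact h1.symm

theorem ricciForm_eq_trCLM (R : Curv V) (X Y : V) :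
    ricciForm R X Y = trCLM V ((R.flip X).flip Y) := rfl

/-- Pair symmetry makes `Z ↦ R_{Z,X} Y` and `Z ↦ R_{Z,Y} X` adjoint to each other. -/
theorem IsCurvatureTensor.ricciForm_comm (hB : B.IsInvertible) (hs : ∀ v w, B v w = B w v)
    {R : Curv V} (hR : IsCurvatureTensor B R) (X Y : V) : ricciForm R X Y = ricciForm R Y X := by
  rw [ricciForm_eq_trCLM, ricciForm_eq_trCLM]
  refine trCLM_eq_of_adjoint hB fun x y => ?_
  change B (R x X Y) y = B x (R y Y X)
  rw [hs x, hR.pair x X Y y, hR.antisymm Y y x, map_neg, neg_apply, hR.skew y Y X x]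

/-- The adjoint of `R_{Y,Z} ∘ A` is `-A ∘ R_{Y,Z}`, so the middle term has trace zero; the traces of
the outer two are Ricci forms by definition. -/
theorem IsCurvatureTensor.trCLM_permeabilityEnd (hB : B.IsInvertible)
    (hs : ∀ v w, B v w = B w v) {R : Curv V} (hR : IsCurvatureTensor B R) {A : V →L[ℝ] V}
    (hA : ∀ v w, B (A v) w = B v (A w)) (Y Z : V) :
    trCLM V (permeabilityEnd R A Y Z) = ricciForm R Y (A Z) - ricciForm R Z (A Y) := by
  have h1 : trCLM V ((R Y Z).comp A) = 0 := by
    have : trCLM V ((R Y Z).comp A) = trCLM V (-(A.comp (R Y Z))) := by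
      refine trCLM_eq_of_adjoint hB fun x y => ?_
      simp only [ContinuousLinearMap.comp_apply, neg_apply, map_neg]
      rw [hR.skew, hs, hA]
    rw [map_neg, trCLM_comp_comm A] at this
    linarith
  have h2 : (R Z).flip (A Y) = -((R.flip Z).flip (A Y)) := by
    ext X
    exact hR.antisymm Z X (A Y)
  rw [permeabilityEnd, map_add, map_add, h1, h2, map_neg, ricciForm_eq_trCLM, ricciForm_eq_trCLM]
  ring

/-- The trace in question is the matrix entry `B([A, Ric] Y, Z)`. -/
theorem IsCurvatureTensor.commute_ricciEnd_iff (hB : B.IsInvertible)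
    (hs : ∀ v w, B v w = B w v) {R : Curv V} (hR : IsCurvatureTensor B R) {A : V →L[ℝ] V}
    (hA : ∀ v w, B (A v) w = B v (A w)) :
    Commute (ricciEnd B R) A ↔ ∀ Y Z, trCLM V (permeabilityEnd R A Y Z) = 0 := by
  have key : ∀ Y Z, trCLM V (permeabilityEnd R A Y Z) =
      B (A (ricciEnd B R Y)) Z - B (ricciEnd B R (A Y)) Z := fun Y Z => by
    rw [hR.trCLM_permeabilityEnd hB hs hA, hA, ricciEnd, apply_endOfForm hB, apply_endOfForm hB,
      hR.ricciForm_comm hB hs Z]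
  constructor
  · intro h Y Z
    have hY : ricciEnd B R (A Y) = A (ricciEnd B R Y) :=
      congrArg (fun L : V →L[ℝ] V => L Y) h.eq
    rw [key, hY, sub_self]
  · intro h
    refine ContinuousLinearMap.ext fun Y => ext_of_form hB fun Z => ?_
    have := key Y Z
    rw [h] at this
    change B (ricciEnd B R (A Y)) Z = B (A (ricciEnd B R Y)) Z
    linarith

/-- For distinct `i, j, k` the map `X ↦ F(X, e_j, e_k)` kills `e_j` and `e_k`, so its trace is the
`i`-th coordinate of `F(e_i, e_j, e_k)`. Rotating the indices yields the other two coordinates of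
the same vector. -/
theorem permeabilityForm_eq_zero_of_three {R : Curv V} (hR : ∀ X Y Z, R X Y Z = -R Y X Z)
    {A : V →L[ℝ] V} (e : Module.Basis (Fin 3) ℝ V)
    (h : ∀ Y Z, trCLM V (permeabilityEnd R A Y Z) = 0) (X Y Z : V) :
    permeabilityForm R A X Y Z = 0 := by
  have coord : ∀ i j k : Fin 3, i ≠ j → j ≠ k → i ≠ k →
      e.repr (permeabilityForm R A (e i) (e j) (e k)) i = 0 := fun i j k hij hjk hik => by
    have hp : permeabilityEnd R A (e j) (e k) =
        (LinearMap.toContinuousLinearMap (e.coord i)).smulRight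
          (permeabilityForm R A (e i) (e j) (e k)) := by
      refine ContinuousLinearMap.coe_injective (e.ext fun l => ?_)
      have hl : l = i ∨ l = j ∨ l = k := by omega
      change permeabilityForm R A (e l) (e j) (e k) = e.coord i (e l) • _
      rcases hl with rfl | rfl | rfl
      · simp
      · simp [permeabilityForm_self_left hR, hij.symm]
      · simp [permeabilityForm_self_outer hR, hik.symm]
    have ht := h (e j) (e k)
    rw [hp, trCLM_smulRight] at ht
    exact ht
  refine permeabilityForm_eq_zero_of_basis e (fun i j k => ?_) X Y Z
  by_cases hij : i = j
  · rw [hij]; exact permeabilityForm_self_left hR A _ _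
  by_cases hjk : j = k
  · rw [hjk]; exact permeabilityForm_self_right hR A _ _
  by_cases hik : i = k
  · rw [hik]; exact permeabilityForm_self_outer hR A _ _
  refine e.ext_elem fun l => ?_
  rw [map_zero, Finsupp.zero_apply]
  have hl : l = i ∨ l = j ∨ l = k := by omega
  rcases hl with rfl | rfl | rfl
  · exact coord _ _ _ hij hjk hik
  · rw [permeabilityForm_rotate]
    exact coord _ _ _ hjk (Ne.symm hik) (Ne.symm hij)
  · rw [permeabilityForm_rotate, permeabilityForm_rotate]
    exact coord _ _ _ (Ne.symm hik) hij (Ne.symm hjk)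

/-- If `R` is the Kulkarni–Nomizu product of the scalar product with a symmetric form `B(T ·, ·)`, then
`[Ric, A] = 0` implies permeability. -/
theorem permeabilityForm_eq_zero_of_commute (hs : ∀ v w, B v w = B w v)
    (hB : B.IsInvertible) {R : Curv V} (hR : IsCurvatureTensor B R) {A T : V →L[ℝ] V}
    (hA : ∀ v w, B (A v) w = B v (A w))
    (hKN : ∀ X Y Z, R X Y Z = B Y Z • T X - B X Z • T Y + B (T Y) Z • X - B (T X) Z • Y)
    (hn : Module.finrank ℝ V ≠ 2) (h : ∀ Y Z, trCLM V (permeabilityEnd R A Y Z) = 0) (X Y Z : V) :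
    permeabilityForm R A X Y Z = 0 := by
  -- Of the four terms of the product, two are rank one in `Z`, each contributing `-B(TX, Y)`, and
  -- the identity term contributes `dim V` times it: this is the factor `dim V - 2`.
  have hric : ∀ X Y, ricciForm R X Y =
      trCLM V T * B X Y + ((Module.finrank ℝ V : ℝ) - 2) * B (T X) Y := fun X Y => by
    have : (R.flip X).flip Y = B X Y • T - (B.flip Y).smulRight (T X)
        + B (T X) Y • ContinuousLinearMap.id ℝ V - ((B.flip Y).comp T).smulRight X := by
      ext Z
      exact hKN Z X Y
    rw [ricciForm_eq_trCLM, this]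
    simp only [map_add, map_sub, map_smul, trCLM_smulRight, trCLM_id, smul_eq_mul,
      ContinuousLinearMap.comp_apply, ContinuousLinearMap.flip_apply]
    ring
  -- The `tr(T) B` part drops out because `A` is self-adjoint, and the remaining factor `dim V - 2`
  -- can be cancelled.
  have hTA : ∀ Y Z, B (T Y) (A Z) = B (T Z) (A Y) := fun Y Z => by
    have h1 := h Y Z
    rw [hR.trCLM_permeabilityEnd hB hs hA, hric, hric, ← hA Z, hs (A Z)] at h1
    have hn' : (Module.finrank ℝ V : ℝ) - 2 ≠ 0 := by
      rw [sub_ne_zero]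
      exact_mod_cast hn
    have h2 : ((Module.finrank ℝ V : ℝ) - 2) * (B (T Y) (A Z) - B (T Z) (A Y)) = 0 := by
      linear_combination h1
    exact sub_eq_zero.mp ((mul_eq_zero.mp h2).resolve_left hn')
  exact permeabilityForm_eq_zero_of_kulkarniNomizu (S := T) (T := ContinuousLinearMap.id ℝ V)
    (b := fun Y Z => B Y Z) (c := fun Y Z => B (T Y) Z) hKN
    (fun Y Z => by rw [hs Y, hA]) hTA X Y Z

end CurvatureAlgebra

/-! ### Levi-Civita connection and curvature symmetries in coordinates -/

section LocalMetric

variable {V : Type*} [NormedAddCommGroup V] [NormedSpace ℝ V]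

/-- `G` is a twice continuously differentiable nondegenerate metric near `x`. -/
structure IsMetricAt (G : V → V →L[ℝ] V →L[ℝ] ℝ) (x : V) : Prop where
  contDiffAt : ContDiffAt ℝ 2 G x
  symm : ∀ᶠ y in 𝓝 x, ∀ v w, G y v w = G y w v
  isInvertible : (G x).IsInvertible

theorem hasFDerivAt_apply_apply {W : Type*} [NormedAddCommGroup W] [NormedSpace ℝ W]
    {G : V → W →L[ℝ] W →L[ℝ] ℝ} {x : V} (h : DifferentiableAt ℝ G x) (v w : W) :
    HasFDerivAt (fun y => G y v w) (((fderiv ℝ G x).flip v).flip w) x := by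
  have h1 := (h.hasFDerivAt.clm_apply (hasFDerivAt_const v x)).clm_apply (hasFDerivAt_const w x)
  exact h1.congr_fderiv (by ext u; simp)

variable {G : V → V →L[ℝ] V →L[ℝ] ℝ} {x : V}

namespace IsMetricAt

theorem differentiableAt (h : IsMetricAt G x) : DifferentiableAt ℝ G x :=
  h.contDiffAt.differentiableAt (by norm_num)

theorem contDiffAt_fderiv (h : IsMetricAt G x) : ContDiffAt ℝ 1 (fderiv ℝ G) x :=
  h.contDiffAt.fderiv_right (by norm_num)

theorem differentiableAt_fderiv (h : IsMetricAt G x) : DifferentiableAt ℝ (fderiv ℝ G) x :=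
  h.contDiffAt_fderiv.differentiableAt (by norm_num)

theorem eventually [CompleteSpace V] (h : IsMetricAt G x) : ∀ᶠ y in 𝓝 x, IsMetricAt G y := by
  have h1 : ∀ᶠ y in 𝓝 x, (G y).IsInvertible := by
    obtain ⟨e, he⟩ := h.isInvertible
    exact h.contDiffAt.continuousAt.eventually (he ▸ e.nhds)
  filter_upwards [h.contDiffAt.eventually (by simp), h.symm.eventually_nhds, h1] with y a b c
  exact ⟨a, b, c⟩

theorem fderiv_symm (h : IsMetricAt G x) (u v w : V) :
    fderiv ℝ G x u v w = fderiv ℝ G x u w v := by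
  have h1 := hasFDerivAt_apply_apply h.differentiableAt v w
  have h2 := hasFDerivAt_apply_apply h.differentiableAt w v
  have h3 : (fun y => G y v w) =ᶠ[𝓝 x] fun y => G y w v := h.symm.mono fun y hy => hy v w
  exact congrArg (fun L : V →L[ℝ] ℝ => L u) (h1.unique (h2.congr_of_eventuallyEq h3))

theorem apply_christoffel (h : IsMetricAt G x) (v w z : V) :
    G x (christoffel G x v w) z = christoffelFirst G x v w z := by
  rw [christoffel_apply, apply_sharp h.isInvertible]

theorem christoffelFirst_symm (h : IsMetricAt G x) (v w z : V) :
    christoffelFirst G x v w z = christoffelFirst G x w v z := by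
  rw [christoffelFirst_apply, christoffelFirst_apply, h.fderiv_symm z v w]
  ring

theorem christoffel_symm (h : IsMetricAt G x) (v w : V) :
    christoffel G x v w = christoffel G x w v :=
  ext_of_form h.isInvertible fun z => by
    rw [h.apply_christoffel, h.apply_christoffel, h.christoffelFirst_symm]

theorem fderiv_eq_christoffelFirst (h : IsMetricAt G x) (u v w : V) :
    fderiv ℝ G x u v w = christoffelFirst G x u v w + christoffelFirst G x u w v := by
  rw [christoffelFirst_apply, christoffelFirst_apply, h.fderiv_symm v u w, h.fderiv_symm u w v,
    h.fderiv_symm w u v]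
  ring

theorem fderiv_eq_christoffel (h : IsMetricAt G x) (u v w : V) :
    fderiv ℝ G x u v w = G x (christoffel G x u v) w + G x v (christoffel G x u w) := by
  rw [h.fderiv_eq_christoffelFirst, h.symm.self_of_nhds v, h.apply_christoffel,
    h.apply_christoffel]

theorem contDiffAt_christoffelFirst (h : IsMetricAt G x) :
    ContDiffAt ℝ 1 (christoffelFirst G) x := by
  have h0 := h.contDiffAt_fderiv
  have hflip : ContDiffAt ℝ 1 (fun y => (fderiv ℝ G y).flip) x :=
    (ContinuousLinearMap.flipₗᵢ ℝ V V (V →L[ℝ] ℝ)).toContinuousLinearEquiv.contDiff.contDiffAt.comp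
      x h0
  exact ((h0.add hflip).sub (contDiffAt_const.clm_comp hflip)).const_smul (1 / 2 : ℝ)

theorem contDiffAt_christoffel [CompleteSpace V] (h : IsMetricAt G x) :
    ContDiffAt ℝ 1 (christoffel G) x := by
  have hinv : ContDiffAt ℝ 1 (fun y => sharp (G y)) x := by
    obtain ⟨e, he⟩ := h.isInvertible
    have h1 : ContDiffAt ℝ 1 (ContinuousLinearMap.inverse (R := ℝ) (M := V) (M₂ := V →L[ℝ] ℝ))
        (G x) := he ▸ contDiffAt_map_inverse e
    exact h1.comp x (h.contDiffAt.of_le (by norm_num))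
  have hc : ContDiffAt ℝ 1
      (fun y => ContinuousLinearMap.compL ℝ V (V →L[ℝ] ℝ) V (sharp (G y))) x :=
    (ContinuousLinearMap.compL ℝ V (V →L[ℝ] ℝ) V).contDiff.contDiffAt.comp x hinv
  exact hc.clm_comp h.contDiffAt_christoffelFirst

theorem differentiableAt_christoffelFirst (h : IsMetricAt G x) :
    DifferentiableAt ℝ (christoffelFirst G) x :=
  h.contDiffAt_christoffelFirst.differentiableAt (by norm_num)

theorem differentiableAt_christoffel [CompleteSpace V] (h : IsMetricAt G x) :
    DifferentiableAt ℝ (christoffel G) x :=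
  h.contDiffAt_christoffel.differentiableAt (by norm_num)

end IsMetricAt

theorem hasFDerivAt_apply_apply_apply {W X : Type*} [NormedAddCommGroup W] [NormedSpace ℝ W]
    [NormedAddCommGroup X] [NormedSpace ℝ X]
    {T : V → W →L[ℝ] W →L[ℝ] W →L[ℝ] X} {x : V} (h : DifferentiableAt ℝ T x) (v w z : W) :
    HasFDerivAt (fun y => T y v w z) ((((fderiv ℝ T x).flip v).flip w).flip z) x := by
  have h1 := ((h.hasFDerivAt.clm_apply (hasFDerivAt_const v x)).clm_apply
    (hasFDerivAt_const w x)).clm_apply (hasFDerivAt_const z x)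
  exact h1.congr_fderiv (by ext u; simp)

namespace IsMetricAt

theorem fderiv_christoffelFirst (h : IsMetricAt G x) (u v w z : V) :
    fderiv ℝ (christoffelFirst G) x u v w z = (1 / 2 : ℝ) * (fderiv ℝ (fderiv ℝ G) x u v w z
      + fderiv ℝ (fderiv ℝ G) x u w v z - fderiv ℝ (fderiv ℝ G) x u z v w) := by
  have h1 := hasFDerivAt_apply_apply_apply h.differentiableAt_christoffelFirst v w z
  have h2 := fun a b c => hasFDerivAt_apply_apply_apply h.differentiableAt_fderiv a b c
  have h3 := ((((h2 v w z).add (h2 w v z)).sub (h2 z v w)).const_mul (1 / 2 : ℝ))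
  exact congrArg (fun L : V →L[ℝ] ℝ => L u) (h1.unique h3)

variable [CompleteSpace V]

/-- Differentiating `G(Γ(v,w), z) = Γ₁(v,w)(z)` avoids any derivative of the inverse metric. -/
theorem apply_secondCovariant (h : IsMetricAt G x) (u v w z : V) :
    G x (secondCovariant G x u v w) z = fderiv ℝ (christoffelFirst G) x u v w z
      - G x (christoffel G x v w) (christoffel G x u z) := by
  have h1 := hasFDerivAt_apply_apply_apply h.differentiableAt_christoffelFirst v w z
  have hΓ := ((h.differentiableAt_christoffel.hasFDerivAt.clm_apply (hasFDerivAt_const v x)).clm_apply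
    (hasFDerivAt_const w x))
  have h2 := (h.differentiableAt.hasFDerivAt.clm_apply hΓ).clm_apply (hasFDerivAt_const z x)
  have h3 : (fun y => christoffelFirst G y v w z) =ᶠ[𝓝 x] fun y => G y (christoffel G y v w) z :=
    h.eventually.mono fun y hy => (hy.apply_christoffel v w z).symm
  have h4 := congrArg (fun L : V →L[ℝ] ℝ => L u) (h1.unique (h2.congr_of_eventuallyEq h3))
  simp at h4
  rw [h4, h.fderiv_eq_christoffel, secondCovariant_apply, map_add, add_apply]
  ring

theorem apply_localCurvature (h : IsMetricAt G x) (u v w z : V) :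
    G x (localCurvature G x u v w) z =
      fderiv ℝ (christoffelFirst G) x u v w z - fderiv ℝ (christoffelFirst G) x v u w z
        - G x (christoffel G x v w) (christoffel G x u z)
        + G x (christoffel G x u w) (christoffel G x v z) := by
  rw [localCurvature_apply, map_sub, sub_apply, h.apply_secondCovariant, h.apply_secondCovariant]
  ring

theorem fderiv_fderiv_symm (h : IsMetricAt G x) (u a v w : V) :
    fderiv ℝ (fderiv ℝ G) x u a v w = fderiv ℝ (fderiv ℝ G) x u a w v := by
  have h1 := hasFDerivAt_apply_apply_apply h.differentiableAt_fderiv a v w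
  have h2 := hasFDerivAt_apply_apply_apply h.differentiableAt_fderiv a w v
  have h3 : (fun y => fderiv ℝ G y a v w) =ᶠ[𝓝 x] fun y => fderiv ℝ G y a w v :=
    h.eventually.mono fun y hy => hy.fderiv_symm a v w
  exact congrArg (fun L : V →L[ℝ] ℝ => L u) (h1.unique (h2.congr_of_eventuallyEq h3))

omit [CompleteSpace V] in
theorem fderiv_fderiv_comm (h : IsMetricAt G x) (u a v w : V) :
    fderiv ℝ (fderiv ℝ G) x u a v w = fderiv ℝ (fderiv ℝ G) x a u v w := by
  rw [(h.contDiffAt.isSymmSndFDerivAt (by simp)).eq u a]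

/-- With all indices lowered, the curvature consists of second derivatives of `G` and products of
Christoffel symbols (`key`). The symmetries then follow from equality of mixed derivatives and the
symmetry of `G` and `Γ`. -/
theorem isCurvatureTensor (h : IsMetricAt G x) :
    IsCurvatureTensor (G x) (localCurvature G x) := by
  have hs := h.symm.self_of_nhds
  have hΓ := h.christoffel_symm
  have key : ∀ u v w z, G x (localCurvature G x u v w) z =
      (1 / 2 : ℝ) * (fderiv ℝ (fderiv ℝ G) x u w v z - fderiv ℝ (fderiv ℝ G) x u z v w
        - fderiv ℝ (fderiv ℝ G) x v w u z + fderiv ℝ (fderiv ℝ G) x v z u w)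
        - G x (christoffel G x v w) (christoffel G x u z)
        + G x (christoffel G x u w) (christoffel G x v z) := fun u v w z => by
    rw [h.apply_localCurvature, h.fderiv_christoffelFirst, h.fderiv_christoffelFirst,
      h.fderiv_fderiv_comm u v]
    ring
  refine ⟨fun X Y Z => ?_, fun X Y Z W => ?_, fun X Y Z W => ?_, fun X Y Z W => ?_⟩
  · rw [localCurvature_apply, localCurvature_apply, neg_sub]
  · rw [key, key, hs (christoffel G x Y W), hs (christoffel G x X W)]
    ring
  · rw [key, key, h.fderiv_fderiv_comm Z X, h.fderiv_fderiv_symm X Z W Y,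
      h.fderiv_fderiv_comm Z Y, h.fderiv_fderiv_symm Y Z W X,
      h.fderiv_fderiv_comm W X, h.fderiv_fderiv_symm X W Z Y,
      h.fderiv_fderiv_comm W Y, h.fderiv_fderiv_symm Y W Z X,
      hs (christoffel G x W X), hΓ W X, hΓ W Y, hΓ Z X, hΓ Z Y]
    ring
  · rw [key, key, key, hΓ Z Y, hΓ X Z, hΓ Y X, h.fderiv_fderiv_comm Z Y, h.fderiv_fderiv_comm Z X,
      h.fderiv_fderiv_comm Y X, h.fderiv_fderiv_symm X W Z Y, h.fderiv_fderiv_symm Y W Z X,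
      h.fderiv_fderiv_symm Z W Y X]
    ring

end IsMetricAt

end LocalMetric

/-! ### Pullback metrics and the Gauss equation in coordinates -/

section LocalGauss

variable {V W : Type*} [NormedAddCommGroup V] [NormedSpace ℝ V]
  [NormedAddCommGroup W] [NormedSpace ℝ W]

/-- The pullback of the metric `G` by the map `F`, in coordinates. -/
noncomputable def localPullback (F : V → W) (G : W → W →L[ℝ] W →L[ℝ] ℝ) (x : V) : V →L[ℝ] V →L[ℝ] ℝ :=
  (G (F x)).bilinearComp (fderiv ℝ F x) (fderiv ℝ F x)

theorem localPullback_apply (F : V → W) (G : W → W →L[ℝ] W →L[ℝ] ℝ) (x v w : V) :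
    localPullback F G x v w = G (F x) (fderiv ℝ F x v) (fderiv ℝ F x w) := rfl

/-- The covariant derivative along `F` of the vector field `dF w`, in the direction `v`. -/
noncomputable def covariantHessian (F : V → W) (G : W → W →L[ℝ] W →L[ℝ] ℝ) (x v w : V) : W :=
  fderiv ℝ (fderiv ℝ F) x v w + christoffel G (F x) (fderiv ℝ F x v) (fderiv ℝ F x w)

/-- The second fundamental form of `F`, with values in the normal space. -/
noncomputable def normalHessian (F : V → W) (G : W → W →L[ℝ] W →L[ℝ] ℝ) (x v w : V) : W :=
  covariantHessian F G x v w - fderiv ℝ F x (christoffel (localPullback F G) x v w)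

variable {F : V → W} {G : W → W →L[ℝ] W →L[ℝ] ℝ} {x : V}

/-- The pullback involves `DF`, so three derivatives of `F` are needed for a `C²` metric. -/
theorem isMetricAt_localPullback (hF : ContDiffAt ℝ 3 F x) (hG : IsMetricAt G (F x))
    (hinv : (localPullback F G x).IsInvertible) : IsMetricAt (localPullback F G) x where
  contDiffAt := by
    have hDF : ContDiffAt ℝ 2 (fderiv ℝ F) x := hF.fderiv_right (by norm_num)
    have hGF : ContDiffAt ℝ 2 (fun y => G (F y)) x :=
      hG.contDiffAt.comp x (hF.of_le (by norm_num))
    have h1 : ContDiffAt ℝ 2 (fun y => (G (F y)).comp (fderiv ℝ F y)) x := hGF.clm_comp hDF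
    have hflip : ContDiffAt ℝ 2 (fun y => ((G (F y)).comp (fderiv ℝ F y)).flip) x :=
      (ContinuousLinearMap.flipₗᵢ ℝ V W ℝ).toContinuousLinearEquiv.contDiff.contDiffAt.comp x h1
    have h2 : ContDiffAt ℝ 2
        (fun y => (((G (F y)).comp (fderiv ℝ F y)).flip).comp (fderiv ℝ F y)) x := hflip.clm_comp hDF
    exact (ContinuousLinearMap.flipₗᵢ ℝ V V ℝ).toContinuousLinearEquiv.contDiff.contDiffAt.comp x h2
  symm := (hF.continuousAt.eventually hG.symm).mono fun y hy v w => hy _ _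
  isInvertible := hinv

theorem covariantHessian_symm (hF : ContDiffAt ℝ 2 F x) (hG : IsMetricAt G (F x)) (v w : V) :
    covariantHessian F G x v w = covariantHessian F G x w v := by
  rw [covariantHessian, covariantHessian, hG.christoffel_symm,
    (hF.isSymmSndFDerivAt (by simp)).eq v w]

theorem hasFDerivAt_fderiv_apply (hF : ContDiffAt ℝ 2 F x) (v : V) :
    HasFDerivAt (fun y => fderiv ℝ F y v) ((fderiv ℝ (fderiv ℝ F) x).flip v) x := by
  have h0 : DifferentiableAt ℝ (fderiv ℝ F) x :=
    (hF.fderiv_right (m := 1) (by norm_num)).differentiableAt (by norm_num)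
  exact (h0.hasFDerivAt.clm_apply (hasFDerivAt_const v x)).congr_fderiv (by ext u; simp)

theorem fderiv_localPullback (hF : ContDiffAt ℝ 2 F x) (hG : IsMetricAt G (F x))
    (hd : DifferentiableAt ℝ (localPullback F G) x) (u v w : V) :
    fderiv ℝ (localPullback F G) x u v w =
      G (F x) (covariantHessian F G x u v) (fderiv ℝ F x w)
        + G (F x) (fderiv ℝ F x v) (covariantHessian F G x u w) := by
  have h1 := hasFDerivAt_apply_apply hd v w
  have hGF := hG.differentiableAt.hasFDerivAt.comp x (hF.differentiableAt (by norm_num)).hasFDerivAt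
  have h2 := (hGF.clm_apply (hasFDerivAt_fderiv_apply hF v)).clm_apply
    (hasFDerivAt_fderiv_apply hF w)
  have h3 := congrArg (fun L : V →L[ℝ] ℝ => L u) (h1.unique h2)
  simp at h3
  rw [h3, hG.fderiv_eq_christoffel]
  simp only [covariantHessian, map_add, add_apply]
  ring

/-- The product rule gives six terms; by symmetry of the covariant Hessian four cancel and two
coincide. So the tangential part of the covariant Hessian is the inner connection. -/
theorem christoffelFirst_localPullback (hF : ContDiffAt ℝ 2 F x) (hG : IsMetricAt G (F x))
    (hd : DifferentiableAt ℝ (localPullback F G) x) (v w z : V) :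
    christoffelFirst (localPullback F G) x v w z =
      G (F x) (covariantHessian F G x v w) (fderiv ℝ F x z) := by
  have hs := hG.symm.self_of_nhds
  have hc := covariantHessian_symm hF hG
  rw [christoffelFirst_apply, fderiv_localPullback hF hG hd, fderiv_localPullback hF hG hd,
    fderiv_localPullback hF hG hd, hc z v, hc z w, hc w v, hs (fderiv ℝ F x w),
    hs (fderiv ℝ F x v)]
  ring

theorem normalHessian_orthogonal (hF : ContDiffAt ℝ 2 F x) (hG : IsMetricAt G (F x))
    (hP : IsMetricAt (localPullback F G) x) (v w z : V) :
    G (F x) (normalHessian F G x v w) (fderiv ℝ F x z) = 0 := by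
  have h1 := hP.apply_christoffel v w z
  rw [christoffelFirst_localPullback hF hG hP.differentiableAt, localPullback_apply] at h1
  rw [normalHessian, map_sub, sub_apply, h1, sub_self]

theorem apply_covariantHessian (hF : ContDiffAt ℝ 2 F x) (hG : IsMetricAt G (F x))
    (hP : IsMetricAt (localPullback F G) x) (a b v w : V) :
    G (F x) (covariantHessian F G x a b) (covariantHessian F G x v w) =
      localPullback F G x (christoffel (localPullback F G) x a b)
        (christoffel (localPullback F G) x v w)
      + G (F x) (normalHessian F G x a b) (normalHessian F G x v w) := by
  have hD : ∀ a b, covariantHessian F G x a b =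
      fderiv ℝ F x (christoffel (localPullback F G) x a b) + normalHessian F G x a b :=
    fun a b => by rw [normalHessian]; abel
  have ho := normalHessian_orthogonal hF hG hP
  have hs := hG.symm.self_of_nhds
  rw [hD a b, hD v w, localPullback_apply]
  simp only [map_add, add_apply, ho]
  rw [hs _ (normalHessian F G x v w), ho]
  ring

variable [CompleteSpace V] [CompleteSpace W]

/-- The long first factor is the covariant derivative of the covariant Hessian along `F`.
Antisymmetrized in `u, v`, it leaves only the outer curvature. -/
theorem fderiv_christoffelFirst_localPullback (hF : ContDiffAt ℝ 3 F x) (hG : IsMetricAt G (F x))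
    (hP : IsMetricAt (localPullback F G) x) (u v w z : V) :
    fderiv ℝ (christoffelFirst (localPullback F G)) x u v w z =
      G (F x) (fderiv ℝ (fderiv ℝ (fderiv ℝ F)) x u v w
        + fderiv ℝ (christoffel G) (F x) (fderiv ℝ F x u) (fderiv ℝ F x v) (fderiv ℝ F x w)
        + christoffel G (F x) (fderiv ℝ (fderiv ℝ F) x u v) (fderiv ℝ F x w)
        + christoffel G (F x) (fderiv ℝ F x v) (fderiv ℝ (fderiv ℝ F) x u w)
        + christoffel G (F x) (fderiv ℝ F x u) (covariantHessian F G x v w)) (fderiv ℝ F x z)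
      + G (F x) (covariantHessian F G x v w) (covariantHessian F G x u z) := by
  have hF2 : ContDiffAt ℝ 2 F x := hF.of_le (by norm_num)
  have h1 := hasFDerivAt_apply_apply_apply hP.differentiableAt_christoffelFirst v w z
  have hdF := (hF.differentiableAt (by norm_num)).hasFDerivAt
  have hGF := hG.differentiableAt.hasFDerivAt.comp x hdF
  have hΓF := hG.differentiableAt_christoffel.hasFDerivAt.comp x hdF
  have hD2 : DifferentiableAt ℝ (fderiv ℝ (fderiv ℝ F)) x :=
    ((hF.fderiv_right (m := 2) (by norm_num)).fderiv_right (m := 1) (by norm_num)).differentiableAt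
      (by norm_num)
  have hC : HasFDerivAt (fun y => covariantHessian F G y v w) _ x :=
    (((hD2.hasFDerivAt.clm_apply (hasFDerivAt_const v x)).clm_apply (hasFDerivAt_const w x)).add
    ((hΓF.clm_apply (hasFDerivAt_fderiv_apply hF2 v)).clm_apply (hasFDerivAt_fderiv_apply hF2 w)))
  have h2 := (hGF.clm_apply hC).clm_apply (hasFDerivAt_fderiv_apply hF2 z)
  have he : (fun y => christoffelFirst (localPullback F G) y v w z) =ᶠ[𝓝 x]
      fun y => G (F y) (covariantHessian F G y v w) (fderiv ℝ F y z) := by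
    filter_upwards [hF2.eventually (by simp), hF.continuousAt.eventually hG.eventually,
      hP.eventually] with y a b c
    exact christoffelFirst_localPullback a b c.differentiableAt v w z
  have h3 := congrArg (fun L : V →L[ℝ] ℝ => L u) (h1.unique (h2.congr_of_eventuallyEq he))
  simp at h3
  rw [h3, hG.fderiv_eq_christoffel]
  have h4 : covariantHessian F G x u z = fderiv ℝ (fderiv ℝ F) x u z
    + christoffel G (F x) (fderiv ℝ F x u) (fderiv ℝ F x z) := rfl
  rw [h4]
  simp only [map_add, add_apply]
  ring

/-- The Gauss equation. -/
theorem gauss_equation (hF : ContDiffAt ℝ 3 F x) (hG : IsMetricAt G (F x))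
    (hP : IsMetricAt (localPullback F G) x) (u v w z : V) :
    localPullback F G x (localCurvature (localPullback F G) x u v w) z =
      G (F x) (localCurvature G (F x) (fderiv ℝ F x u) (fderiv ℝ F x v) (fderiv ℝ F x w))
        (fderiv ℝ F x z)
      + G (F x) (normalHessian F G x v w) (normalHessian F G x u z)
      - G (F x) (normalHessian F G x u w) (normalHessian F G x v z) := by
  have hF2 : ContDiffAt ℝ 2 F x := hF.of_le (by norm_num)
  have h3 : fderiv ℝ (fderiv ℝ (fderiv ℝ F)) x u v w = fderiv ℝ (fderiv ℝ (fderiv ℝ F)) x v u w := by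
    rw [((hF.fderiv_right (m := 2) (by norm_num)).isSymmSndFDerivAt (by simp)).eq u v]
  have h2 : fderiv ℝ (fderiv ℝ F) x u v = fderiv ℝ (fderiv ℝ F) x v u :=
    (hF2.isSymmSndFDerivAt (by simp)).eq u v
  -- The tangential parts of these products cancel the `ΓΓ` terms of the inner curvature; the normal
  -- parts are the Gauss correction.
  have hA := apply_covariantHessian hF2 hG hP v w u z
  have hB := apply_covariantHessian hF2 hG hP u w v z
  rw [hP.apply_localCurvature, fderiv_christoffelFirst_localPullback hF hG hP,
    fderiv_christoffelFirst_localPullback hF hG hP, hA, hB, localCurvature_apply,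
    secondCovariant_apply, secondCovariant_apply, h3, h2]
  have hc : ∀ a b, covariantHessian F G x a b = fderiv ℝ (fderiv ℝ F) x a b
    + christoffel G (F x) (fderiv ℝ F x a) (fderiv ℝ F x b) := fun _ _ => rfl
  rw [hc v w, hc u w]
  simp only [map_add, add_apply, map_sub, sub_apply]
  ring

end LocalGauss

/-! ### Curvature of conformally flat metrics in coordinates -/

section Conformal

variable {V : Type*} [NormedAddCommGroup V] [NormedSpace ℝ V]
  {G : V → V →L[ℝ] V →L[ℝ] ℝ} {x : V} {ψ : V → ℝ}

/-- The conformal metric `e^{2ψ} G`. -/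
noncomputable def conformal (ψ : V → ℝ) (G : V → V →L[ℝ] V →L[ℝ] ℝ) (x : V) : V →L[ℝ] V →L[ℝ] ℝ :=
  Real.exp (2 * ψ x) • G x

theorem conformal_apply (ψ : V → ℝ) (G : V → V →L[ℝ] V →L[ℝ] ℝ) (x v w : V) :
    conformal ψ G x v w = Real.exp (2 * ψ x) * G x v w := rfl

theorem isMetricAt_conformal (hG : IsMetricAt G x) (hψ : ContDiffAt ℝ 2 ψ x) :
    IsMetricAt (conformal ψ G) x where
  contDiffAt := (contDiffAt_const.mul hψ).exp.smul hG.contDiffAt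
  symm := hG.symm.mono fun y hy v w => by rw [conformal_apply, conformal_apply, hy]
  isInvertible := by
    obtain ⟨e, he⟩ := hG.isInvertible
    refine ⟨e.trans (ContinuousLinearEquiv.smulLeft (Units.mk0 _ (Real.exp_pos (2 * ψ x)).ne')), ?_⟩
    rw [conformal, ← he]
    rfl

theorem hasFDerivAt_exp_two_mul (hψ : DifferentiableAt ℝ ψ x) :
    HasFDerivAt (fun y => Real.exp (2 * ψ y)) (Real.exp (2 * ψ x) • (2 : ℝ) • fderiv ℝ ψ x) x :=
  (hψ.hasFDerivAt.const_mul 2).exp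

theorem christoffelFirst_conformal (hG : DifferentiableAt ℝ G x) (hψ : DifferentiableAt ℝ ψ x)
    (v w z : V) : christoffelFirst (conformal ψ G) x v w z =
      Real.exp (2 * ψ x) * (christoffelFirst G x v w z + fderiv ℝ ψ x v * G x w z
        + fderiv ℝ ψ x w * G x v z - fderiv ℝ ψ x z * G x v w) := by
  have hd : fderiv ℝ (conformal ψ G) x = _ := ((hasFDerivAt_exp_two_mul hψ).smul hG.hasFDerivAt).fderiv
  simp only [christoffelFirst_apply, hd, add_apply, smul_apply, ContinuousLinearMap.smulRight_apply,
    smul_eq_mul]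
  ring

variable [CompleteSpace V]

theorem fderiv_christoffelFirst_conformal (hG : IsMetricAt G x) (hψ : ContDiffAt ℝ 2 ψ x)
    (u v w z : V) : fderiv ℝ (christoffelFirst (conformal ψ G)) x u v w z =
      Real.exp (2 * ψ x) * (2 * fderiv ℝ ψ x u * (christoffelFirst G x v w z
        + fderiv ℝ ψ x v * G x w z + fderiv ℝ ψ x w * G x v z - fderiv ℝ ψ x z * G x v w)
      + (fderiv ℝ (christoffelFirst G) x u v w z
        + fderiv ℝ (fderiv ℝ ψ) x u v * G x w z + fderiv ℝ ψ x v * fderiv ℝ G x u w z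
        + fderiv ℝ (fderiv ℝ ψ) x u w * G x v z + fderiv ℝ ψ x w * fderiv ℝ G x u v z
        - fderiv ℝ (fderiv ℝ ψ) x u z * G x v w - fderiv ℝ ψ x z * fderiv ℝ G x u v w)) := by
  have h1 := hasFDerivAt_apply_apply_apply
    (isMetricAt_conformal hG hψ).differentiableAt_christoffelFirst v w z
  have hg := fun a b => hasFDerivAt_apply_apply hG.differentiableAt a b
  have hp := hasFDerivAt_fderiv_apply hψ
  have h2 := (hasFDerivAt_exp_two_mul (hψ.differentiableAt (by norm_num))).mul
    ((((hasFDerivAt_apply_apply_apply hG.differentiableAt_christoffelFirst v w z).add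
      ((hp v).mul (hg w z))).add ((hp w).mul (hg v z))).sub ((hp z).mul (hg v w)))
  have he : (fun y => christoffelFirst (conformal ψ G) y v w z) =ᶠ[𝓝 x] fun y =>
      Real.exp (2 * ψ y) * (christoffelFirst G y v w z + fderiv ℝ ψ y v * G y w z
        + fderiv ℝ ψ y w * G y v z - fderiv ℝ ψ y z * G y v w) := by
    filter_upwards [hψ.eventually (by simp), hG.eventually] with y a b
    exact christoffelFirst_conformal b.differentiableAt (a.differentiableAt (by norm_num)) v w z
  have h3 := congrArg (fun L : V →L[ℝ] ℝ => L u) (h1.unique (h2.congr_of_eventuallyEq he))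
  simp at h3
  rw [h3]
  ring

/-- The curvature tensor of a locally conformally flat metric is a Kulkarni–Nomizu product with the
metric. -/
theorem exists_kulkarniNomizu_of_conformal_flat (hG : IsMetricAt G x) (hψ : ContDiffAt ℝ 2 ψ x)
    (h0 : localCurvature (conformal ψ G) x = 0) :
    ∃ t : V →L[ℝ] V →L[ℝ] ℝ, ∀ u v w z, G x (localCurvature G x u v w) z =
      G x v w * t u z - G x u w * t v z + t v w * G x u z - t u w * G x v z := by
  have hC := isMetricAt_conformal hG hψ
  have hs := hG.symm.self_of_nhds
  have hsψ := (hψ.isSymmSndFDerivAt (by simp)).eq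
  -- The `G`-gradient of `ψ`.
  set n := sharp (G x) (fderiv ℝ ψ x)
  have hnG : ∀ w, G x n w = fderiv ℝ ψ x w := apply_sharp hG.isInvertible _
  have hΓ : ∀ v w, christoffel (conformal ψ G) x v w = christoffel G x v w + fderiv ℝ ψ x v • w
      + fderiv ℝ ψ x w • v - G x v w • n := fun v w => by
    refine ext_of_form hC.isInvertible fun z => ?_
    rw [hC.apply_christoffel, christoffelFirst_conformal hG.differentiableAt
      (hψ.differentiableAt (by norm_num)), conformal_apply]
    simp only [map_add, map_sub, map_smul, add_apply, sub_apply, smul_apply, smul_eq_mul, hnG,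
      hG.apply_christoffel]
    ring
  -- The tensor of the classical conformal change formula, `Hess ψ - dψ ⊗ dψ + ½|dψ|² G`. Here `Hess
  -- ψ = D²ψ - dψ(Γ)`, and `dψ(n)` is `|dψ|²`.
  refine ⟨fderiv ℝ (fderiv ℝ ψ) x
    - (ContinuousLinearMap.compL ℝ V V ℝ (fderiv ℝ ψ x)).comp (christoffel G x)
    - (fderiv ℝ ψ x).smulRight (fderiv ℝ ψ x) + (fderiv ℝ ψ x n / 2) • G x, fun u v w z => ?_⟩
  have h1 : conformal ψ G x (localCurvature (conformal ψ G) x u v w) z = 0 := by simp [h0]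
  rw [hC.apply_localCurvature, fderiv_christoffelFirst_conformal hG hψ,
    fderiv_christoffelFirst_conformal hG hψ, conformal_apply, conformal_apply, hΓ, hΓ, hΓ, hΓ] at h1
  have h2 : Real.exp (2 * ψ x) ≠ 0 := (Real.exp_pos _).ne'
  have hGΓ : ∀ a b c, G x a (christoffel G x b c) = christoffelFirst G x b c a := fun a b c => by
    rw [hs, hG.apply_christoffel]
  have hnG' : ∀ w, G x w n = fderiv ℝ ψ x w := fun w => by rw [hs, hnG]
  rw [hG.apply_localCurvature]
  simp only [map_add, map_sub, map_smul, add_apply, sub_apply, smul_apply, smul_eq_mul, hnG, hnG',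
    hG.apply_christoffel, hGΓ, hG.fderiv_eq_christoffelFirst,
    ContinuousLinearMap.comp_apply, ContinuousLinearMap.compL_apply,
    ContinuousLinearMap.smulRight_apply] at h1 ⊢
  refine mul_left_cancel₀ h2 ?_
  rw [hsψ v u, hs w u, hs w v, hs v u, hG.christoffelFirst_symm v u z, hG.christoffelFirst_symm v u w] at h1
  linear_combination h1

end Conformal

/-! ### Passage from the manifold to its preferred charts -/

section Charts

variable {n k : ℕ} {M : Type*} [TopologicalSpace M] [ChartedSpace (E n) M] [IsManifold (𝓡 n) ∞ M]
  {N : Type*} [TopologicalSpace N] [ChartedSpace (E k) N] [IsManifold (𝓡 k) ∞ N]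

theorem mdifferentiableAt_extChartAt_symm (p : M) {x : E n}
    (hx : x ∈ (extChartAt (𝓡 n) p).target) :
    MDifferentiableAt (𝓡 n) (𝓡 n) (extChartAt (𝓡 n) p).symm x :=
  ((contMDiffOn_extChartAt_symm (n := ∞) p).contMDiffAt
    ((isOpen_extChartAt_target p).mem_nhds hx)).mdifferentiableAt (by simp)

/-- Tensors at `p` therefore coincide with their coordinate expressions at the base point of the
preferred chart. -/
theorem differential_extChartAt_symm (p : M) :
    differential (extChartAt (𝓡 n) p).symm (extChartAt (𝓡 n) p p) = ContinuousLinearMap.id ℝ (E n) := by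
  have : IsManifold (𝓡 n) 1 M := .of_le (n := ∞) (by simp)
  have h := mfderivWithin_range_extChartAt_symm (I := 𝓡 n) (x := p)
  rw [ModelWithCorners.Boundaryless.range_eq_univ, mfderivWithin_univ] at h
  exact h

omit [IsManifold (𝓡 n) ∞ M] in
theorem inChart_apply (g : FormField n M) (p : M) (x v w : E n) :
    inChart g p x v w = g.at ((extChartAt (𝓡 n) p).symm x)
      (differential (extChartAt (𝓡 n) p).symm x v) (differential (extChartAt (𝓡 n) p).symm x w) :=
  rfl

theorem inChart_self (g : FormField n M) (p : M) :
    inChart g p (extChartAt (𝓡 n) p p) = g.at p := by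
  ext v w
  rw [inChart_apply, differential_extChartAt_symm, extChartAt_to_inv]
  rfl

/-- The coordinate vector fields are smooth sections, since the trivialization at `p` turns them
into constants; smoothness of `g` as a bundle section then gives smooth coefficients. -/
theorem contDiffOn_inChart (g : ContMDiffRiemannianMetric (𝓡 n) ∞ (E n)
      (fun q : M => TangentSpace (𝓡 n) q)) (p : M) :
    ContDiffOn ℝ ∞ (inChart g.inner p) (extChartAt (𝓡 n) p).target := by
  have : IsManifold (𝓡 n) 1 M := .of_le (n := ∞) (by simp)
  refine contDiffOn_clm_apply.mpr fun v => contDiffOn_clm_apply.mpr fun w => ?_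
  rw [← contMDiffOn_iff_contDiffOn]
  intro x hx
  set φ := extChartAt (𝓡 n) p with hφ
  have hb : ContMDiffAt (𝓡 n) (𝓡 n) ∞ φ.symm x :=
    (contMDiffOn_extChartAt_symm (n := ∞) p).contMDiffAt ((isOpen_extChartAt_target p).mem_nhds hx)
  have hsec : ∀ v : E n, ContMDiffAt (𝓡 n) ((𝓡 n).prod (𝓘(ℝ, E n))) ∞
      (fun y => TotalSpace.mk' (E n) (E := fun q : M => TangentSpace (𝓡 n) q) (φ.symm y)
        (mfderiv (𝓡 n) (𝓡 n) φ.symm y v)) x := fun v => by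
    have hsrc : ∀ y ∈ φ.target, φ.symm y ∈ (chartAt (E n) p).source := fun y hy => by
      rw [← extChartAt_source (𝓡 n)]
      exact φ.map_target hy
    set e := trivializationAt (E n) (TangentSpace (𝓡 n)) p with he
    have hbase : ∀ y ∈ φ.target, φ.symm y ∈ e.baseSet := fun y hy => by
      simpa [he] using hsrc y hy
    refine (e.contMDiffAt_iff (e.mem_source.mpr (hbase x hx))).mpr ⟨hb, ?_⟩
    refine (contMDiffAt_const (c := v)).congr_of_eventuallyEq ?_
    filter_upwards [(isOpen_extChartAt_target p).mem_nhds hx] with y hy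
    have h1 := mfderiv_extChartAt_comp_mfderivWithin_extChartAt_symm (I := 𝓡 n) hy
    rw [ModelWithCorners.Boundaryless.range_eq_univ, mfderivWithin_univ,
      ← TangentBundle.continuousLinearMapAt_trivializationAt (hsrc y hy)] at h1
    have h2 := congrArg (fun L : E n →L[ℝ] E n => L v) h1
    refine Eq.trans ?_ h2
    exact (congrFun (e.coe_linearMapAt_of_mem (R := ℝ) (hbase y hy)) _).symm
  have : ContMDiffAt (𝓡 n) ((𝓡 n).prod 𝓘(ℝ)) ∞
      (fun m ↦ TotalSpace.mk' ℝ (E := Bundle.Trivial M ℝ) (φ.symm m)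
        (g.inner (φ.symm m) (mfderiv (𝓡 n) (𝓡 n) φ.symm m v) (mfderiv (𝓡 n) (𝓡 n) φ.symm m w))) x := by
    apply ContMDiffAt.clm_bundle_apply₂ (F₁ := E n) (F₂ := E n)
    · exact g.contMDiff.contMDiffAt.comp x hb
    · exact hsec v
    · exact hsec w
  simp only [contMDiffAt_totalSpace] at this
  exact this.2.contMDiffWithinAt

theorem isMetricAt_inChart (g : ContMDiffRiemannianMetric (𝓡 n) ∞ (E n)
      (fun q : M => TangentSpace (𝓡 n) q)) (p : M) :
    IsMetricAt (inChart g.inner p) (extChartAt (𝓡 n) p p) where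
  contDiffAt := ((contDiffOn_inChart g p).contDiffAt (extChartAt_target_mem_nhds p)).of_le
    ENat.LEInfty.out
  symm := .of_forall fun y v w => g.symm _ _ _
  isInvertible := by
    rw [inChart_self]
    exact isInvertible_of_pos fun v hv => g.pos p v hv

omit [IsManifold (𝓡 n) ∞ M] [IsManifold (𝓡 k) ∞ N] in
theorem fderiv_writtenInExtChartAt {f : M → N} (hf : ContMDiff (𝓡 n) (𝓡 k) ∞ f) (p : M) :
    fderiv ℝ (writtenInExtChartAt (𝓡 n) (𝓡 k) p f) (extChartAt (𝓡 n) p p) = differential f p := by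
  have h := ((hf.mdifferentiable (by simp)) p).mfderiv
  rw [ModelWithCorners.Boundaryless.range_eq_univ, fderivWithin_univ] at h
  exact h.symm

omit [IsManifold (𝓡 n) ∞ M] [IsManifold (𝓡 k) ∞ N] in
theorem writtenInExtChartAt_self (f : M → N) (p : M) :
    writtenInExtChartAt (𝓡 n) (𝓡 k) p f (extChartAt (𝓡 n) p p) = extChartAt (𝓡 k) (f p) (f p) := by
  simp [writtenInExtChartAt]

omit [IsManifold (𝓡 n) ∞ M] [IsManifold (𝓡 k) ∞ N] in
theorem contDiffAt_writtenInExtChartAt {f : M → N} (hf : ContMDiff (𝓡 n) (𝓡 k) ∞ f) (p : M) :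
    ContDiffAt ℝ ∞ (writtenInExtChartAt (𝓡 n) (𝓡 k) p f) (extChartAt (𝓡 n) p p) := by
  have h := (contMDiffAt_iff.mp (hf p)).2
  rw [ModelWithCorners.Boundaryless.range_eq_univ, contDiffWithinAt_univ] at h
  exact h

/-- The chain rule applied to `ψ⁻¹ ∘ F = f ∘ φ⁻¹`. Equality of germs is needed because curvature
differentiates the metric. -/
theorem inChart_pullback {f : M → N} (hf : ContMDiff (𝓡 n) (𝓡 k) ∞ f) (g : FormField k N) (p : M) :
    inChart (pullback f g) p =ᶠ[𝓝 (extChartAt (𝓡 n) p p)]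
      localPullback (writtenInExtChartAt (𝓡 n) (𝓡 k) p f) (inChart g (f p)) := by
  set φ := extChartAt (𝓡 n) p with hφ
  set ψ := extChartAt (𝓡 k) (f p) with hψ
  set F := writtenInExtChartAt (𝓡 n) (𝓡 k) p f with hF
  have h1 : ∀ᶠ x in 𝓝 (φ p), x ∈ φ.target := extChartAt_target_mem_nhds p
  have h2 : ∀ᶠ x in 𝓝 (φ p), f (φ.symm x) ∈ ψ.source := by
    have hc : ContinuousAt (f ∘ φ.symm) (φ p) := by
      refine ContinuousAt.comp ?_ (continuousAt_extChartAt_symm p)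
      exact hf.continuous.continuousAt
    refine hc.eventually_mem ?_
    rw [Function.comp_apply, extChartAt_to_inv]
    exact extChartAt_source_mem_nhds (f p)
  have h3 : ∀ᶠ x in 𝓝 (φ p), ContDiffAt ℝ 1 F x :=
    ((contDiffAt_writtenInExtChartAt hf p).of_le ENat.LEInfty.out).eventually (by simp)
  filter_upwards [h1, h2.eventually_nhds, h3] with x hx hxs hFx
  have e1 : (ψ.symm ∘ F) =ᶠ[𝓝 x] f ∘ φ.symm := hxs.mono fun y hy => ψ.left_inv hy
  have e2 : ψ.symm (F x) = f (φ.symm x) := e1.self_of_nhds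
  have hFt : F x ∈ ψ.target := ψ.map_source hxs.self_of_nhds
  have e3 : mfderiv (𝓡 n) (𝓡 k) (ψ.symm ∘ F) x = mfderiv (𝓡 n) (𝓡 k) (f ∘ φ.symm) x := e1.mfderiv_eq
  have hFd : MDifferentiableAt (𝓡 n) (𝓡 k) F x :=
    (hFx.differentiableAt (by norm_num)).mdifferentiableAt
  rw [mfderiv_comp x (mdifferentiableAt_extChartAt_symm (f p) hFt) hFd,
    mfderiv_comp x (hf.mdifferentiable (by simp) _) (mdifferentiableAt_extChartAt_symm p hx),
    mfderiv_eq_fderiv] at e3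
  have e4 : ∀ v : E n, differential ψ.symm (F x) (fderiv ℝ F x v) =
      differential f (φ.symm x) (differential φ.symm x v) := fun v =>
    congrArg (fun L : E n →L[ℝ] E k => L v) e3
  ext v w
  rw [localPullback_apply, inChart_apply, inChart_apply, e4, e4, e2]
  rfl

end Charts

/-! ### Christoffel symbols and curvature depend only on the germ of the metric -/

section Congr

variable {V : Type*} [NormedAddCommGroup V] [NormedSpace ℝ V]
  {G G' : V → V →L[ℝ] V →L[ℝ] ℝ} {x : V}

theorem christoffel_congr (h : G =ᶠ[𝓝 x] G') : christoffel G =ᶠ[𝓝 x] christoffel G' := by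
  filter_upwards [h, h.fderiv (𝕜 := ℝ)] with y h1 h2
  rw [christoffel, christoffel, christoffelFirst, christoffelFirst, h1, h2]

theorem localCurvature_congr (h : G =ᶠ[𝓝 x] G') : localCurvature G x = localCurvature G' x := by
  have h1 := christoffel_congr h
  rw [localCurvature, localCurvature, secondCovariant, secondCovariant, h1.fderiv_eq,
    h1.self_of_nhds]

end Congr

/-! ### Curvature of the ambient manifold -/

section OuterManifold

variable {n : ℕ} {M : Type*} [TopologicalSpace M] [ChartedSpace (E n) M] [IsManifold (𝓡 n) ∞ M]
  (g : ContMDiffRiemannianMetric (𝓡 n) ∞ (E n) (fun q : M => TangentSpace (𝓡 n) q))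

theorem metric_symm (q : M) (v w : E n) :
    FormField.at g.inner q v w = FormField.at g.inner q w v := g.symm q v w

theorem metric_pos (q : M) (v : E n) (hv : v ≠ 0) : 0 < FormField.at g.inner q v v := g.pos q v hv

theorem isCurvatureTensor_curvature (q : M) :
    IsCurvatureTensor (FormField.at g.inner q) (curvature g.inner q) := by
  rw [← inChart_self]
  exact (isMetricAt_inChart g q).isCurvatureTensor

theorem exists_kulkarniNomizu_of_isConformallyFlat (h : IsConformallyFlat g.inner) (q : M) :
    ∃ t : E n →L[ℝ] E n →L[ℝ] ℝ, ∀ u v w z,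
      FormField.at g.inner q (curvature g.inner q u v w) z =
        FormField.at g.inner q v w * t u z - FormField.at g.inner q u w * t v z
          + t v w * FormField.at g.inner q u z - t u w * FormField.at g.inner q v z := by
  obtain ⟨U, hU, hq, φ, hφ, h0⟩ := h q
  have hψ : ContDiffAt ℝ 2 (φ ∘ (extChartAt (𝓡 n) q).symm) (extChartAt (𝓡 n) q q) := by
    have h1 : ContMDiffAt (𝓡 n) 𝓘(ℝ, ℝ) ∞ φ ((extChartAt (𝓡 n) q).symm (extChartAt (𝓡 n) q q)) := by
      rw [extChartAt_to_inv]
      exact hφ.contMDiffAt (hU.mem_nhds hq)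
    have h2 : ContMDiffAt (𝓡 n) (𝓡 n) ∞ (extChartAt (𝓡 n) q).symm (extChartAt (𝓡 n) q q) :=
      (contMDiffOn_extChartAt_symm (n := ∞) q).contMDiffAt (extChartAt_target_mem_nhds q)
    exact (contMDiffAt_iff_contDiffAt.mp (h1.comp _ h2)).of_le ENat.LEInfty.out
  -- The chart expression of `e^{2φ} g` unfolds to `conformal` of `φ` read in the chart, so flatness
  -- applies as it stands.
  have := exists_kulkarniNomizu_of_conformal_flat (isMetricAt_inChart g q) hψ (h0 q hq)
  rwa [inChart_self] at this

theorem curvature_of_hasConstantCurvature {c : ℝ} (h : HasConstantCurvature g.inner c) (q : M)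
    (X Y Z W : E n) : FormField.at g.inner q (curvature g.inner q X Y Z) W =
      c * (FormField.at g.inner q Y Z * FormField.at g.inner q X W
        - FormField.at g.inner q X Z * FormField.at g.inner q Y W) := by
  have hR := isCurvatureTensor_curvature g q
  have hs := metric_symm g q
  have hp := metric_pos g q
  refine hR.apply_eq_of_planes hs (fun X Y => ?_) X Y Z W
  have hsec := h q X Y
  rw [sectionalCurvature] at hsec
  set B := FormField.at g.inner q
  set R := curvature g.inner q
  have hXX : ∀ X Z W, B (R X X Z) W = 0 := fun X Z W => by
    have := hR.antisymm X X Z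
    have h2 : B (R X X Z) W = -B (R X X Z) W := by
      nth_rw 1 [this]
      rw [map_neg, neg_apply]
    linarith
  by_cases hli : LinearIndependent ℝ ![X, Y]
  · have hgram : B X X * B Y Y - B X Y ^ 2 ≠ 0 := by
      intro h0
      -- The square length of this vector is `B(Y,Y)` times the Gram determinant.
      have hw : B Y Y • X + (-B X Y) • Y = 0 := by
        by_contra hne
        have := hp _ hne
        simp only [map_add, map_smul, add_apply, smul_apply, smul_eq_mul] at this
        rw [hs Y X] at this
        have h3 : 0 < B Y Y * (B X X * B Y Y - B X Y ^ 2) := by linarith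
        rw [h0, mul_zero] at h3
        exact lt_irrefl _ h3
      have h1 := (LinearIndependent.pair_iff.mp hli _ _ hw).1
      have hY : Y ≠ 0 := hli.ne_zero 1
      exact (hp Y hY).ne' h1
    exact (div_eq_iff hgram).mp (hsec hli)
  -- For dependent vectors the curvature hypothesis is silent, but both sides vanish.
  · rw [LinearIndependent.pair_iff] at hli
    push Not at hli
    obtain ⟨s, t, hst, hne⟩ := hli
    by_cases hs0 : s = 0
    · have ht : t ≠ 0 := hne hs0
      have hY : Y = 0 := by
        rw [hs0, zero_smul, zero_add] at hst
        exact (smul_eq_zero.mp hst).resolve_left ht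
      simp [hY]
    · have hX : X = (-(t / s)) • Y := by
        have h1 : s • X = (-t) • Y := by
          rw [neg_smul]
          exact eq_neg_of_add_eq_zero_left hst
        rw [← inv_smul_smul₀ hs0 X, h1, smul_smul]
        congr 1
        field_simp
      rw [hX]
      simp only [map_smul, smul_apply, smul_eq_mul, hXX]
      ring

end OuterManifold

/-! ### The immersed hypersurface: Gauss equation, shape operator, permeability -/

section Immersion

variable {m : ℕ}
  {N : Type*} [TopologicalSpace N] [ChartedSpace (E (m + 1)) N]
  {M : Type*} [TopologicalSpace M] [ChartedSpace (E m) M]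

theorem pullback_at_apply (h : FormField (m + 1) N) (f : M → N) (p : M) (v w : E m) :
    FormField.at (pullback f h) p v w =
      FormField.at h (f p) (differential f p v) (differential f p w) := rfl

variable [IsManifold (𝓡 (m + 1)) ∞ N]
  (g : ContMDiffRiemannianMetric (𝓡 (m + 1)) ∞ (E (m + 1)) (fun q : N => TangentSpace (𝓡 (m + 1)) q))

theorem pullback_symm (f : M → N) (p : M) (v w : E m) :
    FormField.at (pullback f g.inner) p v w = FormField.at (pullback f g.inner) p w v :=
  metric_symm g _ _ _

theorem isMetricAt_outer (f : M → N) (p : M) :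
    IsMetricAt (inChart g.inner (f p))
    (writtenInExtChartAt (𝓡 m) (𝓡 (m + 1)) p f (extChartAt (𝓡 m) p p)) := by
  rw [writtenInExtChartAt_self]
  exact isMetricAt_inChart g (f p)

theorem outer_at_eq (f : M → N) (p : M) :
    inChart g.inner (f p)
    (writtenInExtChartAt (𝓡 m) (𝓡 (m + 1)) p f (extChartAt (𝓡 m) p p)) =
      FormField.at g.inner (f p) := by
  rw [writtenInExtChartAt_self, inChart_self]

variable [IsManifold (𝓡 m) ∞ M] {f : M → N} (hf : IsSmoothImmersion m f) (p : M)

include hf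

omit [IsManifold (𝓡 (m + 1)) ∞ N] [IsManifold (𝓡 m) ∞ M] in
theorem eq_zero_of_differential_eq_zero {X : E m}
    (hX : differential (n := m) (k := m + 1) f p X = 0) : X = 0 :=
  hf.injective_mfderiv p (hX.trans (map_zero (differential (n := m) (k := m + 1) f p)).symm)

omit [IsManifold (𝓡 m) ∞ M] in
theorem pullback_isInvertible : (FormField.at (n := m) (pullback f g.inner) p).IsInvertible := by
  refine isInvertible_of_pos fun v hv => ?_
  rw [pullback_at_apply]
  exact metric_pos g _ _ fun h0 => hv (eq_zero_of_differential_eq_zero hf p h0)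

theorem localPullback_inChart : localPullback (writtenInExtChartAt (𝓡 m) (𝓡 (m + 1)) p f)
    (inChart g.inner (f p)) (extChartAt (𝓡 m) p p) = FormField.at (pullback f g.inner) p := by
  rw [← (inChart_pullback hf.contMDiff g.inner p).self_of_nhds, inChart_self]

theorem isMetricAt_inner : IsMetricAt (localPullback (writtenInExtChartAt (𝓡 m) (𝓡 (m + 1)) p f)
    (inChart g.inner (f p))) (extChartAt (𝓡 m) p p) := by
  refine isMetricAt_localPullback
    ((contDiffAt_writtenInExtChartAt hf.contMDiff p).of_le ENat.LEInfty.out)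
    (isMetricAt_outer g f p) ?_
  rw [localPullback_inChart g hf p]
  exact pullback_isInvertible g hf p

theorem innerCurvature_eq : innerCurvature m f g.inner p =
    localCurvature (localPullback (writtenInExtChartAt (𝓡 m) (𝓡 (m + 1)) p f)
      (inChart g.inner (f p))) (extChartAt (𝓡 m) p p) :=
  localCurvature_congr (inChart_pullback hf.contMDiff g.inner p)

theorem isCurvatureTensor_innerCurvature :
    IsCurvatureTensor (FormField.at (pullback f g.inner) p) (innerCurvature m f g.inner p) := by
  rw [innerCurvature_eq g hf p, ← localPullback_inChart g hf p]
  exact (isMetricAt_inner g hf p).isCurvatureTensor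

omit [IsManifold (𝓡 m) ∞ M] in
theorem apply_intermediateCurvature (X Y Z W : E m) :
    FormField.at (pullback f g.inner) p (intermediateCurvature m f g.inner p X Y Z) W =
      FormField.at g.inner (f p) (curvature g.inner (f p) (differential f p X) (differential f p Y)
        (differential f p Z)) (differential f p W) := by
  rw [intermediateCurvature_apply, tangentialProjection_apply,
    apply_sharp (pullback_isInvertible g hf p)]
  rfl

omit [IsManifold (𝓡 m) ∞ M] in
-- Paired with tangent vectors, the projection is invisible, so the symmetries are inherited from
-- the ambient curvature.
theorem isCurvatureTensor_intermediateCurvature :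
    IsCurvatureTensor (FormField.at (pullback f g.inner) p)
      (intermediateCurvature m f g.inner p) := by
  have hR := isCurvatureTensor_curvature g (f p)
  refine ⟨fun X Y Z => ?_, fun X Y Z W => ?_, fun X Y Z W => ?_, fun X Y Z W => ?_⟩
  · rw [intermediateCurvature_apply, intermediateCurvature_apply, hR.antisymm, map_neg]
  · simp only [apply_intermediateCurvature g hf p]
    exact hR.skew _ _ _ _
  · simp only [apply_intermediateCurvature g hf p]
    exact hR.pair _ _ _ _
  · simp only [apply_intermediateCurvature g hf p]
    exact hR.bianchi _ _ _ _

theorem hessian_eq_normalHessian (X Y : E m) : hessian m f g.inner p X Y =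
    normalHessian (writtenInExtChartAt (𝓡 m) (𝓡 (m + 1)) p f) (inChart g.inner (f p))
      (extChartAt (𝓡 m) p p) X Y := by
  have h1 : christoffelAt (pullback f g.inner) p = _ :=
    (christoffel_congr (inChart_pullback hf.contMDiff g.inner p)).self_of_nhds
  rw [hessian_apply, normalHessian, covariantHessian, h1, fderiv_writtenInExtChartAt hf.contMDiff,
    writtenInExtChartAt_self]
  rfl

theorem hessian_symm (X Y : E m) : hessian m f g.inner p X Y = hessian m f g.inner p Y X := by
  rw [hessian_eq_normalHessian g hf p, hessian_eq_normalHessian g hf p, normalHessian, normalHessian,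
    (isMetricAt_inner g hf p).christoffel_symm, covariantHessian_symm
      ((contDiffAt_writtenInExtChartAt hf.contMDiff p).of_le ENat.LEInfty.out)
      (isMetricAt_outer g f p)]

theorem hessian_orthogonal (X Y Z : E m) :
    FormField.at g.inner (f p) (hessian m f g.inner p X Y) (differential f p Z) = 0 := by
  have h := normalHessian_orthogonal
    ((contDiffAt_writtenInExtChartAt hf.contMDiff p).of_le ENat.LEInfty.out)
      (isMetricAt_outer g f p) (isMetricAt_inner g hf p) X Y Z
  rwa [← hessian_eq_normalHessian g hf p, fderiv_writtenInExtChartAt hf.contMDiff,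
    outer_at_eq g f p] at h

theorem apply_innerCurvature (X Y Z W : E m) :
    FormField.at (pullback f g.inner) p (innerCurvature m f g.inner p X Y Z) W =
      FormField.at (pullback f g.inner) p (intermediateCurvature m f g.inner p X Y Z) W
      + FormField.at g.inner (f p) (hessian m f g.inner p Y Z) (hessian m f g.inner p X W)
      - FormField.at g.inner (f p) (hessian m f g.inner p X Z) (hessian m f g.inner p Y W) := by
  have h := gauss_equation
    ((contDiffAt_writtenInExtChartAt hf.contMDiff p).of_le ENat.LEInfty.out)
      (isMetricAt_outer g f p) (isMetricAt_inner g hf p) X Y Z W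
  simp only [← hessian_eq_normalHessian g hf p] at h
  rw [fderiv_writtenInExtChartAt hf.contMDiff, outer_at_eq g f p, localPullback_inChart g hf p,
    ← innerCurvature_eq g hf p, writtenInExtChartAt_self] at h
  rw [h, apply_intermediateCurvature g hf p]
  rfl

omit [IsManifold (𝓡 m) ∞ M] in
theorem apply_shapeOperator (ν : E (m + 1)) (X Y : E m) :
    FormField.at (pullback f g.inner) p (shapeOperator m f g.inner p ν X) Y =
      FormField.at g.inner (f p) ν (hessian m f g.inner p X Y) :=
  apply_endOfForm (pullback_isInvertible g hf p) _ X Y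

theorem shapeOperator_symm (ν : E (m + 1)) (X Y : E m) :
    FormField.at (pullback f g.inner) p (shapeOperator m f g.inner p ν X) Y =
      FormField.at (pullback f g.inner) p X (shapeOperator m f g.inner p ν Y) := by
  rw [pullback_symm g f p X, apply_shapeOperator g hf p, apply_shapeOperator g hf p,
    hessian_symm g hf p]

variable {ν : E (m + 1)} (hν : IsUnitNormal m f g.inner p ν)

include hν

omit [IsManifold (𝓡 m) ∞ M] in
/-- The normal space of a hypersurface is spanned by a unit normal vector. -/
theorem eq_smul_normal {a : E (m + 1)}
    (ha : ∀ Z : E m, FormField.at g.inner (f p) a (differential f p Z) = 0) :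
    a = FormField.at g.inner (f p) ν a • ν := by
  set B := FormField.at g.inner (f p)
  have hs := metric_symm g (f p)
  -- Codimension one enters here: this map is injective between spaces of equal dimension, so
  -- tangent vectors and `ν` span everything.
  let L : (E m × ℝ) →ₗ[ℝ] E (m + 1) :=
    ((differential f p : E m →L[ℝ] E (m + 1)) : E m →ₗ[ℝ] E (m + 1)).coprod (LinearMap.toSpanSingleton ℝ _ ν)
  have hL : ∀ X t, L (X, t) = differential f p X + t • ν := fun X t => rfl
  have hinj : Function.Injective L := by
    rw [← LinearMap.ker_eq_bot, LinearMap.ker_eq_bot']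
    rintro ⟨X, t⟩ h0
    rw [hL] at h0
    have h1 : B ν (differential f p X + t • ν) = 0 := by rw [h0, map_zero]
    rw [map_add, map_smul, hν.2, hν.1, smul_eq_mul, mul_one, zero_add] at h1
    rw [h1, zero_smul, add_zero] at h0
    have hX : X = 0 := eq_zero_of_differential_eq_zero hf p h0
    rw [hX, h1]
    rfl
  have hdim : Module.finrank ℝ (E m × ℝ) = Module.finrank ℝ (E (m + 1)) := by simp
  have hsurj := (LinearMap.injective_iff_surjective_of_finrank_eq_finrank hdim).mp hinj
  refine ext_of_form (isInvertible_of_pos (metric_pos g (f p))) fun w => ?_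
  obtain ⟨⟨X, t⟩, rfl⟩ := hsurj w
  change B a (L (X, t)) = B (B ν a • ν) (L (X, t))
  rw [hL, map_smul, smul_apply, map_add, map_smul, map_add, map_smul, ha, hν.1, hν.2, hs a ν]
  simp only [smul_eq_mul, mul_one, zero_add]
  exact mul_comm _ _

/-- The Gauss equation, once the normal vectors in it are written as multiples of the unit vector
`ν`. -/
theorem innerCurvature_sub_intermediateCurvature (X Y Z : E m) :
    innerCurvature m f g.inner p X Y Z - intermediateCurvature m f g.inner p X Y Z =
      FormField.at (pullback f g.inner) p (shapeOperator m f g.inner p ν Y) Z •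
        shapeOperator m f g.inner p ν X
      - FormField.at (pullback f g.inner) p (shapeOperator m f g.inner p ν X) Z •
        shapeOperator m f g.inner p ν Y := by
  have hn : ∀ X Y X' Y', FormField.at g.inner (f p) (hessian m f g.inner p X Y)
      (hessian m f g.inner p X' Y') =
      FormField.at g.inner (f p) ν (hessian m f g.inner p X Y) *
        FormField.at g.inner (f p) ν (hessian m f g.inner p X' Y') := fun X Y X' Y' => by
    conv_lhs => rw [eq_smul_normal g hf p hν (hessian_orthogonal g hf p X Y)]
    rw [map_smul, smul_apply, smul_eq_mul]
  refine ext_of_form (pullback_isInvertible g hf p) fun W => ?_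
  rw [map_sub, map_sub, sub_apply, sub_apply, map_smul, map_smul, smul_apply, smul_apply,
    apply_innerCurvature g hf p, hn, hn]
  simp only [apply_shapeOperator g hf p, smul_eq_mul]
  ring

/-- The difference of the curvatures is built from `b = II` and `S = II`, and `b(Y, II Z) = g(II Y,
II Z)` is symmetric, so its cyclic sum vanishes. -/
theorem permeabilityForm_innerCurvature (X Y Z : E m) :
    permeabilityForm (innerCurvature m f g.inner p) (shapeOperator m f g.inner p ν) X Y Z =
      permeabilityForm (intermediateCurvature m f g.inner p) (shapeOperator m f g.inner p ν)
        X Y Z := by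
  have h : permeabilityForm (innerCurvature m f g.inner p - intermediateCurvature m f g.inner p)
      (shapeOperator m f g.inner p ν) X Y Z = 0 := by
    refine permeabilityForm_eq_zero_of_kulkarniNomizu (S := shapeOperator m f g.inner p ν) (T := 0)
      (b := fun Y Z => FormField.at (pullback f g.inner) p (shapeOperator m f g.inner p ν Y) Z)
      (c := fun _ _ => 0) (fun X Y Z => ?_) (fun Y Z => pullback_symm g f p _ _) (fun _ _ => rfl)
      X Y Z
    simpa using innerCurvature_sub_intermediateCurvature g hf p hν X Y Z
  have h2 := permeabilityForm_add (intermediateCurvature m f g.inner p)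
    (innerCurvature m f g.inner p - intermediateCurvature m f g.inner p)
    (shapeOperator m f g.inner p ν) X Y Z
  rwa [h, add_zero, add_sub_cancel] at h2

theorem permeabilityForm_eq_zero_of_isConformallyFlat (hc : IsConformallyFlat g.inner)
    (h : Commute (intermediateRicci m f g.inner p) (shapeOperator m f g.inner p ν)) (X Y Z : E m) :
    permeabilityForm (intermediateCurvature m f g.inner p) (shapeOperator m f g.inner p ν)
      X Y Z = 0 := by
  have hB := pullback_isInvertible g hf p
  have hs := pullback_symm g f p
  have hR := isCurvatureTensor_intermediateCurvature g hf p
  have hA := shapeOperator_symm g hf p ν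
  by_cases hm : m = 2
  · subst hm
    exact permeabilityForm_eq_zero_of_two hR.antisymm _
      (EuclideanSpace.basisFun (Fin 2) ℝ).toBasis X Y Z
  · obtain ⟨t, ht⟩ := exists_kulkarniNomizu_of_isConformallyFlat g hc (f p)
    -- Restricting the ambient tensor `t` to tangent vectors turns the decomposition of `R^out` into
    -- one of `R^inter`.
    let T : E m →L[ℝ] E m := endOfForm (FormField.at (pullback f g.inner) p)
      (t.bilinearComp (differential f p) (differential f p))
    have hT : ∀ X W, FormField.at (pullback f g.inner) p (T X) W =
        t (differential f p X) (differential f p W) := fun X W => apply_endOfForm hB _ X W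
    refine permeabilityForm_eq_zero_of_commute hs hB hR hA (T := T) (fun X Y Z => ?_) ?_
      ((hR.commute_ricciEnd_iff hB hs hA).mp h) X Y Z
    · refine ext_of_form hB fun W => ?_
      rw [apply_intermediateCurvature g hf p, ht]
      simp only [map_sub, map_add, map_smul, add_apply, sub_apply, smul_apply, smul_eq_mul, hT]
      rfl
    · rwa [finrank_euclideanSpace_fin]

omit hν in
theorem permeabilityForm_eq_zero_of_hasConstantCurvature {c : ℝ}
    (hc : HasConstantCurvature g.inner c) (X Y Z : E m) :
    permeabilityForm (intermediateCurvature m f g.inner p) (shapeOperator m f g.inner p ν)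
      X Y Z = 0 := by
  have hB := pullback_isInvertible g hf p
  have hs := pullback_symm g f p
  have hA := shapeOperator_symm g hf p ν
  refine permeabilityForm_eq_zero_of_kulkarniNomizu (S := c • ContinuousLinearMap.id ℝ (E m)) (T := 0)
    (b := fun Y Z => FormField.at (pullback f g.inner) p Y Z) (c := fun _ _ => 0)
    (fun X Y Z => ?_) (fun Y Z => by rw [hs Y, hA]) (fun _ _ => rfl) X Y Z
  refine ext_of_form hB fun W => ?_
  rw [apply_intermediateCurvature g hf p, curvature_of_hasConstantCurvature g hc]
  simp [pullback_at_apply]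
  ring

end Immersion

end Hypersurface

/-! ### The three statements -/

theorem mainTheorem6 (m : ℕ)
    {Mout : Type*} [TopologicalSpace Mout] [ChartedSpace (EuclideanSpace ℝ (Fin (m + 1))) Mout]
    [IsManifold (𝓡 (m + 1)) ∞ Mout]
    {M : Type*} [TopologicalSpace M] [ChartedSpace (EuclideanSpace ℝ (Fin m)) M]
    [IsManifold (𝓡 m) ∞ M]
    (g : ContMDiffRiemannianMetric (𝓡 (m + 1)) ∞ (EuclideanSpace ℝ (Fin (m + 1)))
      (fun q : Mout => TangentSpace (𝓡 (m + 1)) q))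
    (f : M → Mout) (hf : Hypersurface.IsSmoothImmersion m f) :
    (Hypersurface.IsPermeable m f g.inner →
      ∀ (p : M) (ν : EuclideanSpace ℝ (Fin (m + 1))), Hypersurface.IsUnitNormal m f g.inner p ν →
        Commute (Hypersurface.innerRicci m f g.inner p) (Hypersurface.shapeOperator m f g.inner p ν) ∧
        Commute (Hypersurface.intermediateRicci m f g.inner p)
          (Hypersurface.shapeOperator m f g.inner p ν)) ∧
    ((m = 3 ∨ Hypersurface.IsConformallyFlat g.inner) →
      (∀ (p : M) (ν : EuclideanSpace ℝ (Fin (m + 1))), Hypersurface.IsUnitNormal m f g.inner p ν →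
        Commute (Hypersurface.intermediateRicci m f g.inner p)
          (Hypersurface.shapeOperator m f g.inner p ν)) →
      Hypersurface.IsPermeable m f g.inner) ∧
    (∀ c : ℝ, Hypersurface.HasConstantCurvature g.inner c →
      Hypersurface.IsPermeable m f g.inner) := by
  open Hypersurface in
  refine ⟨fun h p ν hν => ?_, fun hc h p ν hν X Y Z => ?_, fun c hc p ν hν X Y Z => ?_⟩
  · have hB := pullback_isInvertible g hf p
    have hs := pullback_symm g f p
    have hA := shapeOperator_symm g hf p ν
    have htr : ∀ R : Curv (E m), (∀ X Y Z, permeabilityForm R (shapeOperator m f g.inner p ν) X Y Z = 0) →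
        ∀ Y Z, trCLM (E m) (permeabilityEnd R (shapeOperator m f g.inner p ν) Y Z) = 0 :=
      fun R hR Y Z => by
        have : permeabilityEnd R (shapeOperator m f g.inner p ν) Y Z = 0 :=
          ContinuousLinearMap.ext fun X => hR X Y Z
        rw [this, map_zero]
    refine ⟨((isCurvatureTensor_innerCurvature g hf p).commute_ricciEnd_iff hB hs hA).mpr
      (htr _ (h p ν hν)),
      ((isCurvatureTensor_intermediateCurvature g hf p).commute_ricciEnd_iff hB hs hA).mpr
      (htr _ fun X Y Z => ?_)⟩
    rw [← permeabilityForm_innerCurvature g hf p hν]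
    exact h p ν hν X Y Z
  · refine (permeabilityForm_innerCurvature g hf p hν X Y Z).trans ?_
    rcases hc with rfl | hc
    · have hR := isCurvatureTensor_intermediateCurvature g hf p
      exact permeabilityForm_eq_zero_of_three hR.antisymm
        (EuclideanSpace.basisFun (Fin 3) ℝ).toBasis
        ((hR.commute_ricciEnd_iff (pullback_isInvertible g hf p) (pullback_symm g f p)
          (shapeOperator_symm g hf p ν)).mp (h p ν hν)) X Y Z
    · exact permeabilityForm_eq_zero_of_isConformallyFlat g hf p hν hc (h p ν hν) X Y Z
  · exact (permeabilityForm_innerCurvature g hf p hν X Y Z).trans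
      (permeabilityForm_eq_zero_of_hasConstantCurvature g hf p hc X Y Z)
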